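/- Let $X$ be a finite (abstract) simplicial complex, i.e. a finite set of finite sets closed under taking subsets; a face with $i+1$ elements has dimension $i$, and the empty set is a face of dimension $-1$. The geometric carrier $|X|$ is the space of all functions $f:V(X)\to[0,1]$ on the vertex set with $\sum_v f(v)=1$ whose support is a face of $X$, with the subspace topology from $[0,1]^{V(X)}$; $X$ is called connected if $|X|$ is connected, and $X$ is called a triangulated $2$-sphere if $|X|$ is homeomorphic to the $2$-sphere. The complex $X$ is a $2$-dimensional normal pseudomanifold if it has dimension $2$, all its maximal faces have dimension $2$, every edge lies in exactly two $2$-faces, and the link of every face of dimension at most $0$ (including the empty face, whose link is $X$) is connected. For a positive integer $q$, a $d$-dimensional complex $X$ is (Gromov) $q$-rigid if it is connected and, for every set $A$ of vertices of $X$ disjoint from at least one $d$-face of $X$, at least $q\cdot\#(A)$ edges of $X$ intersect $A$; it is minimally $q$-rigid if it is $q$-rigid and has exactly $(n-d-1)q+\binom{d+1}{2}$ edges, where $n$ is its number of vertices (for $d=2$ and $q=3$ this number is $3n-6$). Theorem. Let $X$ be a $2$-dimensional normal pseudomanifold. Then $X$ is $3$-rigid. Moreover, $X$ is minimally $3$-rigid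 if and only if $X$ is a triangulated $2$-sphere. -/

import Mathlib

namespace PreAbstractSimplicialComplex

/-- The vertex set of `X`. In Mathlib's `PreAbstractSimplicialComplex` the faces are nonempty
finite sets; the empty face, of dimension `-1`, is treated separately where it matters. -/
def vertexSet {V : Type*} (X : PreAbstractSimplicialComplex V) : Set V :=
  {v | {v} ∈ X.faces}

/-- The geometric carrier of `X`: the functions `f : V(X) → [0, 1]` with sum `1` whose support
is a face of `X`. It carries the topology of a subspace of `[0, 1] ^ V(X)`. -/
def carrier {V : Type*} (X : PreAbstractSimplicialComplex V) :
    Set (X.vertexSet → unitInterval) :=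
  {f | ∑ᶠ v, (f v : ℝ) = 1 ∧ ∃ σ ∈ X.faces, ∀ v : X.vertexSet, f v ≠ 0 ↔ (v : V) ∈ σ}

/-- `X` is connected if its geometric carrier is a connected (nonempty) space. -/
def IsConnectedComplex {V : Type*} (X : PreAbstractSimplicialComplex V) : Prop :=
  ConnectedSpace X.carrier

/-- `X` has dimension `d`: the maximum of the dimensions `#σ - 1` of its faces is `d`. -/
def HasDim {V : Type*} (X : PreAbstractSimplicialComplex V) (d : ℕ) : Prop :=
  (∃ σ ∈ X.faces, σ.card = d + 1) ∧ ∀ σ ∈ X.faces, σ.card ≤ d + 1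

/-- `X` is pure of dimension `d`: it has dimension `d` and so do all its maximal faces. -/
def IsPure {V : Type*} (X : PreAbstractSimplicialComplex V) (d : ℕ) : Prop :=
  X.HasDim d ∧ ∀ σ, Maximal (· ∈ X.faces) σ → σ.card = d + 1

/-- The link of `σ` in `X`: the faces `τ` disjoint from `σ` with `σ ∪ τ` a face of `X`.
The link of the empty face is `X` itself. -/
def link {V : Type*} [DecidableEq V] (X : PreAbstractSimplicialComplex V) (σ : Finset V) :
    PreAbstractSimplicialComplex V where
  faces := {τ | τ.Nonempty ∧ Disjoint σ τ ∧ σ ∪ τ ∈ X.faces}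
  isRelLowerSet_faces := by
    rintro τ ⟨hne, hdis, hmem⟩
    refine ⟨hne, fun ρ hρ hρne => ⟨hρne, hdis.mono_right hρ, ?_⟩⟩
    exact (X.isRelLowerSet_faces hmem).2 (Finset.union_subset_union_right hρ)
      (hρne.mono Finset.subset_union_right)

/-- A weak pseudomanifold (without boundary) of dimension `d ≥ 1`: a pure `d`-dimensional complex
in which each `(d - 1)`-face is contained in exactly two facets. -/
def IsWeakPseudomanifold {V : Type*} (X : PreAbstractSimplicialComplex V) (d : ℕ) : Prop :=
  1 ≤ d ∧ X.IsPure d ∧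
    ∀ τ ∈ X.faces, τ.card = d → {σ ∈ X.faces | σ.card = d + 1 ∧ τ ⊆ σ}.ncard = 2

/-- A normal pseudomanifold of dimension `d`: a weak pseudomanifold in which each face of
dimension `#σ - 1 ≤ d - 2`, the empty face included, has a connected link. -/
def IsNormalPseudomanifold {V : Type*} [DecidableEq V] (X : PreAbstractSimplicialComplex V)
    (d : ℕ) : Prop :=
  X.IsWeakPseudomanifold d ∧
    ∀ σ : Finset V, (σ = ∅ ∨ σ ∈ X.faces) → σ.card + 1 ≤ d → (X.link σ).IsConnectedComplex

/-- The edges (1-dimensional faces) of `X`. -/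
def edges {V : Type*} (X : PreAbstractSimplicialComplex V) : Set (Finset V) :=
  {e ∈ X.faces | e.card = 2}

/-- Gromov `q`-rigidity of a `d`-dimensional complex `X`: `X` is connected and, for every
set `A` of vertices that is disjoint from some `d`-face, at least `q * #A` edges meet `A`. -/
def IsRigid {V : Type*} (X : PreAbstractSimplicialComplex V) (q : ℕ) : Prop :=
  X.IsConnectedComplex ∧ ∃ d, X.HasDim d ∧
    ∀ A : Finset V, (∀ v ∈ A, v ∈ X.vertexSet) →
      (∃ σ ∈ X.faces, σ.card = d + 1 ∧ Disjoint A σ) →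
      A.card * q ≤ {e ∈ X.edges | ∃ v ∈ e, v ∈ A}.ncard

/-- Minimal `q`-rigidity of a `d`-dimensional complex `X` with `n` vertices: `X` is `q`-rigid and
has exactly `(n - d - 1) q + (d + 1).choose 2` edges. -/
def IsMinimallyRigid {V : Type*} (X : PreAbstractSimplicialComplex V) (q : ℕ) : Prop :=
  X.IsRigid q ∧ ∃ d, X.HasDim d ∧
    (X.edges.ncard : ℤ) = ((X.vertexSet.ncard : ℤ) - d - 1) * q + ((d + 1).choose 2 : ℕ)

/-- `X` is a triangulated `d`-sphere: its geometric carrier is homeomorphic to the unit sphere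
of `(d + 1)`-dimensional Euclidean space. -/
def IsTriangulatedSphere {V : Type*} (X : PreAbstractSimplicialComplex V) (d : ℕ) : Prop :=
  Nonempty (X.carrier ≃ₜ Metric.sphere (0 : EuclideanSpace ℝ (Fin (d + 1))) 1)

end PreAbstractSimplicialComplex

/-! ### Closed surfaces as sets of triangles, and local replacement. -/

section Combinatorics

variable {V : Type*} [DecidableEq V]

/-! Everything is reduced to the set of triangles of the complex, with face numbers f₀, f₁, f₂ and
homology mod 2. Connectedness of a link or of the whole complex becomes connectedness of triangles
through common edges, and double counting gives 2f₁ = 3f₂.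

Rigidity (`IsSurface.rigid`). If the graph induced on A is disconnected, A splits into two parts
that no edge joins, and induction applies. Otherwise consider the subcomplex induced on A. It misses
a triangle, hence carries no nonzero 2-cycle, and it is connected, so its numbers of vertices, edges
and triangles satisfy |A| - e + t ≤ 1. Counting triangle by triangle, the number of edges meeting A
is 3(e - t) + N, where N counts the triangles with exactly one vertex in A. A parity argument in
vertex links gives N ≥ 3 when A is nonempty, and the bound 3|A| follows.

Minimality. The extremal edge number 3f₀ - 6 is equivalent, by 2f₁ = 3f₂, to f₂ + 4 = 2f₀, that is,
to Euler characteristic 2. It remains to see that this characterizes spheres.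

From characteristic 2 to a sphere (`IsSurface.nonempty_homeomorph_sphere`). The ranks of the
boundary maps force first homology to vanish mod 2, so a closed path of three edges separates the
triangles. Let a, b, c, d be consecutive in the link of a vertex v. If a ≠ d, then ac and bd cannot
both be edges, since the cycle vac would separate b from d; so vb or vc can be flipped, which lowers
the degree of v and keeps the realization up to homeomorphism. If a = d, then v has degree three:
either the surface is the boundary of a tetrahedron, or v can be removed. A double induction on the
number of vertices and the degree of v concludes.

From a sphere to characteristic 2 (`exists_coboundary`, `IsSurface.card_eq_of_cocycles`). A
1-cocycle mod 2 defines a double cover of the realization. A sphere minus a point is a plane, which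
is simply connected, so the cover has a section there. With the point removed from the interior of a
triangle, the section is defined along all edges, and its sheets at the vertices exhibit the cocycle
as a coboundary. The rank count then gives f₁ = (f₀ - 1) + (f₂ - 1). -/

/-- The set of triangles of a closed triangulated surface: every edge lies in exactly two
triangles, and for `σ` empty or a single vertex the triangles containing `σ` are connected
through common edges. -/
structure IsSurface (T : Finset (Finset V)) : Prop where
  card_eq : ∀ t ∈ T, t.card = 3
  card_filter : ∀ e : Finset V, e.card = 2 → (∃ t ∈ T, e ⊆ t) → (T.filter (e ⊆ ·)).card = 2
  conn : ∀ σ : Finset V, σ.card ≤ 1 → ∀ h : Finset V → Prop,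
    (∀ s ∈ T, ∀ t ∈ T, σ ⊆ s → σ ⊆ t → (s ∩ t).card = 2 → h s → h t) →
    ∀ s ∈ T, ∀ t ∈ T, σ ⊆ s → σ ⊆ t → h s → h t

/-- The vertices of the triangles in `T`. -/
def triVerts (T : Finset (Finset V)) : Finset V := T.biUnion id

/-- The edges of the triangles in `T`. -/
def triEdges (T : Finset (Finset V)) : Finset (Finset V) := T.biUnion (Finset.powersetCard 2)

lemma mem_triVerts {T : Finset (Finset V)} {v : V} : v ∈ triVerts T ↔ ∃ t ∈ T, v ∈ t := by
  simp [triVerts]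

lemma mem_triEdges {T : Finset (Finset V)} {e : Finset V} :
    e ∈ triEdges T ↔ e.card = 2 ∧ ∃ t ∈ T, e ⊆ t := by
  simp only [triEdges, Finset.mem_biUnion, Finset.mem_powersetCard]
  tauto

lemma subset_triVerts {T : Finset (Finset V)} {t : Finset V} (ht : t ∈ T) : t ⊆ triVerts T :=
  fun _ hv => mem_triVerts.2 ⟨t, ht, hv⟩

lemma Finset.inter_eq_of_card {e s t : Finset V} (he : e.card = 2) (hs : s.card = 3)
    (ht : t.card = 3) (hes : e ⊆ s) (het : e ⊆ t) (hst : s ≠ t) : s ∩ t = e := by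
  symm
  apply Finset.eq_of_subset_of_card_le (Finset.subset_inter hes het)
  by_contra hc
  have h1 : s ∩ t = s := Finset.eq_of_subset_of_card_le Finset.inter_subset_left (by omega)
  have h2 : s ∩ t = t := Finset.eq_of_subset_of_card_le Finset.inter_subset_right (by omega)
  exact hst (h1.symm.trans h2)

lemma Finset.card_three_of_ne {a b c : V} (hab : a ≠ b) (hac : a ≠ c) (hbc : b ≠ c) :
    ({a, b, c} : Finset V).card = 3 := Finset.card_eq_three.2 ⟨a, b, c, hab, hac, hbc, rfl⟩

lemma Finset.exists_eq_insert_of_pair_subset {t : Finset V} (ht : t.card = 3) {a b : V} (hab : a ≠ b)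
    (h : ({a, b} : Finset V) ⊆ t) : ∃ c, c ≠ a ∧ c ≠ b ∧ t = {a, b, c} := by
  have hc : (t \ {a, b}).card = 1 := by
    rw [Finset.card_sdiff_of_subset h, ht, Finset.card_pair hab]
  obtain ⟨c, hc⟩ := Finset.card_eq_one.1 hc
  have hct : c ∈ t \ {a, b} := by rw [hc]; simp
  simp only [Finset.mem_sdiff, Finset.mem_insert, Finset.mem_singleton, not_or] at hct
  refine ⟨c, hct.2.1, hct.2.2, ?_⟩
  rw [← Finset.sdiff_union_of_subset h, hc]
  ext x; simp; tauto

namespace IsSurface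

variable {T : Finset (Finset V)}

lemma exists_other (hT : IsSurface T) {t e : Finset V} (ht : t ∈ T) (he : e.card = 2)
    (het : e ⊆ t) :
    ∃ t' ∈ T, t' ≠ t ∧ e ⊆ t' ∧ ∀ s ∈ T, e ⊆ s → s = t ∨ s = t' := by
  have h2 := hT.card_filter e he ⟨t, ht, het⟩
  obtain ⟨x, y, hxy, hE⟩ := Finset.card_eq_two.1 h2
  have hm : ∀ s, (s ∈ T ∧ e ⊆ s) ↔ s = x ∨ s = y := by
    intro s
    have := congrArg (s ∈ ·) hE
    simpa using this
  rcases (hm t).1 ⟨ht, het⟩ with rfl | rfl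
  · obtain ⟨h3, h4⟩ := (hm y).2 (Or.inr rfl)
    exact ⟨y, h3, hxy.symm, h4, fun s h5 h6 => (hm s).1 ⟨h5, h6⟩⟩
  · obtain ⟨h3, h4⟩ := (hm x).2 (Or.inl rfl)
    exact ⟨x, h3, hxy, h4, fun s h5 h6 => ((hm s).1 ⟨h5, h6⟩).symm⟩

/-- The other triangle on an edge, by its vertices. -/
lemma exists_other_vertex (hT : IsSurface T) {a b c : V} (hab : a ≠ b) (hac : a ≠ c)
    (hbc : b ≠ c) (ht : ({a, b, c} : Finset V) ∈ T) :
    ∃ d, d ≠ a ∧ d ≠ b ∧ d ≠ c ∧ {a, b, d} ∈ T ∧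
      ∀ s ∈ T, {a, b} ⊆ s → s = {a, b, c} ∨ s = {a, b, d} := by
  obtain ⟨t', ht', hne, hsub, hall⟩ := hT.exists_other (e := {a, b}) ht (Finset.card_pair hab)
    (by intro x; simp; tauto)
  obtain ⟨d, hda, hdb, rfl⟩ := Finset.exists_eq_insert_of_pair_subset (hT.card_eq _ ht') hab hsub
  refine ⟨d, hda, hdb, ?_, ht', hall⟩
  rintro rfl
  exact hne rfl

lemma two_mul_card_edges (hT : IsSurface T) : 2 * (triEdges T).card = 3 * T.card := by
  have h := Finset.sum_card_bipartiteAbove_eq_sum_card_bipartiteBelow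
    (s := triEdges T) (t := T) (fun e t => e ⊆ t)
  have h1 : ∑ e ∈ triEdges T, (Finset.bipartiteAbove (fun e t => e ⊆ t) T e).card
      = (triEdges T).card * 2 := by
    apply Finset.sum_const_nat
    intro e he
    rw [mem_triEdges] at he
    exact hT.card_filter e he.1 he.2
  have h2 : ∑ t ∈ T, (Finset.bipartiteBelow (fun e t => e ⊆ t) (triEdges T) t).card
      = T.card * 3 := by
    apply Finset.sum_const_nat
    intro t ht
    have : Finset.bipartiteBelow (fun e t => e ⊆ t) (triEdges T) t = t.powersetCard 2 := by
      ext e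
      simp only [Finset.mem_bipartiteBelow, mem_triEdges, Finset.mem_powersetCard]
      constructor
      · rintro ⟨⟨h1, _⟩, h2⟩; exact ⟨h2, h1⟩
      · rintro ⟨h2, h1⟩; exact ⟨⟨h1, t, ht, h2⟩, h2⟩
    rw [this, Finset.card_powersetCard, hT.card_eq t ht]
    rfl
  omega

/-- Replacing the triangles `D` of a surface by triangles `D'` with the same boundary. -/
lemma replace {R D D' : Finset (Finset V)} (hT : IsSurface (R ∪ D)) (hRD : Disjoint R D)
    (hRD' : Disjoint R D') (hcard : ∀ t ∈ D', t.card = 3)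
    (hedge : ∀ e : Finset V, e.card = 2 →
      (D.filter (e ⊆ ·)).card = (D'.filter (e ⊆ ·)).card ∨
      ((D.filter (e ⊆ ·)).card = 2 ∧ (D'.filter (e ⊆ ·)).card = 0) ∨
      ((∀ t ∈ R ∪ D, ¬ e ⊆ t) ∧ (D'.filter (e ⊆ ·)).card = 2))
    (hadj : ∀ s ∈ D', ∀ t ∈ D', s ≠ t → (s ∩ t).card = 2)
    (hsub : ∀ t ∈ D', ∀ x ∈ t, ∃ s ∈ D, x ∈ s) (hne : D.Nonempty) :
    IsSurface (R ∪ D') := by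
  have cU : ∀ e : Finset V, ((R ∪ D).filter (e ⊆ ·)).card =
      (R.filter (e ⊆ ·)).card + (D.filter (e ⊆ ·)).card := fun e => by
    rw [Finset.filter_union, Finset.card_union_of_disjoint (Finset.disjoint_filter_filter hRD)]
  have cU' : ∀ e : Finset V, ((R ∪ D').filter (e ⊆ ·)).card =
      (R.filter (e ⊆ ·)).card + (D'.filter (e ⊆ ·)).card := fun e => by
    rw [Finset.filter_union, Finset.card_union_of_disjoint (Finset.disjoint_filter_filter hRD')]
  have hcard' : ∀ t ∈ R ∪ D', t.card = 3 := by
    intro t ht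
    rcases Finset.mem_union.1 ht with ht | ht
    · exact hT.card_eq t (Finset.mem_union_left _ ht)
    · exact hcard t ht
  refine ⟨hcard', ?_, ?_⟩
  · rintro e he ⟨t, ht, het⟩
    have hpos : 0 < ((R ∪ D').filter (e ⊆ ·)).card :=
      Finset.card_pos.2 ⟨t, Finset.mem_filter.2 ⟨ht, het⟩⟩
    have h0 : ((R ∪ D).filter (e ⊆ ·)).card = 0 ∨ ((R ∪ D).filter (e ⊆ ·)).card = 2 := by
      by_cases hex : ∃ t ∈ R ∪ D, e ⊆ t
      · exact Or.inr (hT.card_filter e he hex)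
      · left
        push Not at hex
        rw [Finset.card_eq_zero, Finset.filter_eq_empty_iff]
        exact fun t ht => hex t ht
    have h1 : (∀ t ∈ R ∪ D, ¬ e ⊆ t) → ((R ∪ D).filter (e ⊆ ·)).card = 0 := by
      intro h
      rw [Finset.card_eq_zero, Finset.filter_eq_empty_iff]
      exact fun t ht => h t ht
    have h2 := cU e
    have h3 := cU' e
    rcases hedge e he with h | ⟨h, h'⟩ | ⟨h, h'⟩
    · omega
    · omega
    · have := h1 h
      omega
  · intro σ hσ h' hh'
    have hsymm : ∀ s ∈ R ∪ D', ∀ t ∈ R ∪ D', σ ⊆ s → σ ⊆ t → (s ∩ t).card = 2 → (h' s ↔ h' t) :=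
      fun s hs t ht h1 h2 h3 => ⟨hh' s hs t ht h1 h2 h3,
        hh' t ht s hs h2 h1 (by rwa [Finset.inter_comm])⟩
    have hD' : ∀ s ∈ D', ∀ t ∈ D', σ ⊆ s → σ ⊆ t → (h' s ↔ h' t) := by
      intro s hs t ht h1 h2
      by_cases hst : s = t
      · rw [hst]
      · exact hsymm s (Finset.mem_union_right _ hs) t (Finset.mem_union_right _ ht) h1 h2
          (hadj s hs t ht hst)
    -- Any two triangles of `D'` are adjacent, so `h'` has a single truth value on those containing
    -- `σ`; `p` is that value. Below, `h` carries `h'` back to the old surface by giving all of `D`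
    -- the value `p`.
    let p : Prop := ∃ t ∈ D', σ ⊆ t ∧ h' t
    have hp : ∀ t ∈ D', σ ⊆ t → (h' t ↔ p) := fun t ht h1 =>
      ⟨fun h => ⟨t, ht, h1, h⟩, fun ⟨s, hs, h2, h3⟩ => (hD' s hs t ht h2 h1).1 h3⟩
    let h : Finset V → Prop := fun t => (t ∈ R ∧ h' t) ∨ (t ∈ D ∧ p)
    have hR : ∀ t ∈ R, (h t ↔ h' t) := fun t ht => by
      have := Finset.disjoint_left.1 hRD ht
      simp [h, ht, this]
    have hD : ∀ t ∈ D, (h t ↔ p) := fun t ht => by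
      have := Finset.disjoint_right.1 hRD ht
      simp [h, ht, this]
    -- An edge shared by `R` and `D` lies in one triangle of each, hence on the boundary of `D`. By
    -- `hedge` it also lies in a triangle of `D'`, which is adjacent to `s`.
    have key : ∀ s ∈ R, ∀ t ∈ D, σ ⊆ s → σ ⊆ t → (s ∩ t).card = 2 → (h' s ↔ p) := by
      intro s hs t ht h1 h2 h3
      have hRpos : 0 < (R.filter (s ∩ t ⊆ ·)).card :=
        Finset.card_pos.2 ⟨s, Finset.mem_filter.2 ⟨hs, Finset.inter_subset_left⟩⟩
      have hDpos : 0 < (D.filter (s ∩ t ⊆ ·)).card :=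
        Finset.card_pos.2 ⟨t, Finset.mem_filter.2 ⟨ht, Finset.inter_subset_right⟩⟩
      have htot := hT.card_filter (s ∩ t) h3
        ⟨t, Finset.mem_union_right _ ht, Finset.inter_subset_right⟩
      rw [cU] at htot
      have hD'pos : 0 < (D'.filter (s ∩ t ⊆ ·)).card := by
        rcases hedge _ h3 with h | ⟨h, _⟩ | ⟨h, _⟩
        · omega
        · omega
        · exact absurd Finset.inter_subset_right (h t (Finset.mem_union_right _ ht))
      obtain ⟨t', ht'⟩ := Finset.card_pos.1 hD'pos
      rw [Finset.mem_filter] at ht'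
      have hst' : s ≠ t' := fun h => Finset.disjoint_left.1 hRD' hs (h ▸ ht'.1)
      have hi := Finset.inter_eq_of_card h3 (hcard' s (Finset.mem_union_left _ hs))
        (hcard t' ht'.1) Finset.inter_subset_left ht'.2 hst'
      have hσt' : σ ⊆ t' := (Finset.subset_inter h1 h2).trans ht'.2
      rw [hsymm s (Finset.mem_union_left _ hs) t' (Finset.mem_union_right _ ht'.1) h1 hσt'
        (by rw [hi, h3])]
      exact hp t' ht'.1 hσt'
    have hconn := hT.conn σ hσ h (by
      intro s hs t ht h1 h2 h3 h4
      rcases Finset.mem_union.1 hs with hs | hs <;> rcases Finset.mem_union.1 ht with ht | ht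
      · rw [hR _ ht, ← hsymm s (Finset.mem_union_left _ hs) t (Finset.mem_union_left _ ht) h1 h2 h3,
          ← hR _ hs]; exact h4
      · rw [hD _ ht, ← key s hs t ht h1 h2 h3, ← hR _ hs]; exact h4
      · rw [hR _ ht, key t ht s hs h2 h1 (by rwa [Finset.inter_comm]), ← hD _ hs]; exact h4
      · rw [hD _ ht, ← hD _ hs]; exact h4)
    have hconn' : ∀ s ∈ R ∪ D, ∀ t ∈ R ∪ D, σ ⊆ s → σ ⊆ t → (h s ↔ h t) :=
      fun s hs t ht h1 h2 => ⟨hconn s hs t ht h1 h2, hconn t ht s hs h2 h1⟩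
    have hex : ∀ t ∈ D', σ ⊆ t → ∃ d ∈ D, σ ⊆ d := by
      intro t ht h1
      rcases Nat.lt_or_ge σ.card 1 with h | h
      · obtain ⟨d, hd⟩ := hne
        have : σ = ∅ := Finset.card_eq_zero.1 (by omega)
        exact ⟨d, hd, by simp [this]⟩
      · obtain ⟨x, rfl⟩ := Finset.card_eq_one.1 (le_antisymm hσ h)
        obtain ⟨d, hd, hx⟩ := hsub t ht x (by simpa using h1)
        exact ⟨d, hd, by simpa using hx⟩
    have key2 : ∀ s ∈ R, ∀ t ∈ D', σ ⊆ s → σ ⊆ t → (h' s ↔ h' t) := by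
      intro s hs t ht h1 h2
      obtain ⟨d, hd, hσd⟩ := hex t ht h2
      rw [hp t ht h2, ← hD d hd, ← hR s hs]
      exact hconn' s (Finset.mem_union_left _ hs) d (Finset.mem_union_right _ hd) h1 hσd
    intro s hs t ht h1 h2 h3
    rcases Finset.mem_union.1 hs with hs | hs <;> rcases Finset.mem_union.1 ht with ht | ht
    · rw [← hR _ ht, ← hconn' s (Finset.mem_union_left _ hs) t (Finset.mem_union_left _ ht) h1 h2,
        hR _ hs]; exact h3
    · exact (key2 s hs t ht h1 h2).1 h3
    · exact (key2 t ht s hs h2 h1).2 h3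
    · exact (hD' s hs t ht h1 h2).1 h3

end IsSurface

end Combinatorics

/-! ### Rank estimates for three-term complexes. -/

section LinearAlgebra

open Matrix Module

variable {m n k K : Type*} [Fintype n] [Field K]

/-- Any one coordinate is injective on a kernel of constant vectors, so the nullity is at most one.
-/
lemma Matrix.card_le_rank_add_one_of_ker (M : Matrix m n K)
    (h : ∀ x, M *ᵥ x = 0 → ∀ i j, x i = x j) : Fintype.card n ≤ M.rank + 1 := by
  classical
  have hr := LinearMap.finrank_range_add_finrank_ker M.mulVecLin
  rw [Module.finrank_fintype_fun_eq_card] at hr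
  have hk : finrank K (LinearMap.ker M.mulVecLin) ≤ 1 := by
    rcases isEmpty_or_nonempty n with hn | ⟨⟨i⟩⟩
    · have : Fintype.card n = 0 := Fintype.card_eq_zero
      omega
    · have := LinearMap.finrank_le_finrank_of_injective
        (f := (LinearMap.proj i : (n → K) →ₗ[K] K).comp (LinearMap.ker M.mulVecLin).subtype) (by
          rw [← LinearMap.ker_eq_bot, LinearMap.ker_eq_bot']
          rintro ⟨x, hx⟩ h0
          ext j
          rw [LinearMap.mem_ker, Matrix.mulVecLin_apply] at hx
          have h0' : x i = 0 := h0
          simpa [h0'] using h x hx j i)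
      simpa using this
  rw [Matrix.rank]
  omega

lemma Matrix.rank_add_one_le_of_mulVec_one [Nonempty n] (M : Matrix m n K) (h : M *ᵥ 1 = 0) :
    M.rank + 1 ≤ Fintype.card n := by
  classical
  have hr := LinearMap.finrank_range_add_finrank_ker M.mulVecLin
  rw [Module.finrank_fintype_fun_eq_card] at hr
  have hk : 0 < finrank K (LinearMap.ker M.mulVecLin) := by
    rw [Module.finrank_pos_iff]
    refine ⟨⟨⟨1, by simpa using h⟩, 0, ?_⟩⟩
    intro h0
    obtain ⟨i⟩ := ‹Nonempty n›
    have := congrFun (congrArg Subtype.val h0) i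
    simp at this
  rw [Matrix.rank]
  omega

lemma Matrix.rank_eq_card_of_ker (M : Matrix m n K)
    (h : ∀ x, M *ᵥ x = 0 → x = 0) : M.rank = Fintype.card n := by
  classical
  have hr := LinearMap.finrank_range_add_finrank_ker M.mulVecLin
  rw [Module.finrank_fintype_fun_eq_card] at hr
  have hk : LinearMap.ker M.mulVecLin = ⊥ := by
    rw [LinearMap.ker_eq_bot']
    intro x hx
    exact h x (by simpa using hx)
  rw [hk, finrank_bot] at hr
  rw [Matrix.rank]
  omega

/-- Exactness of a three-term complex from a dimension count. -/
lemma Matrix.exists_mulVec_eq_of_rank [Fintype k] (M : Matrix m n K) (N : Matrix n k K) (hMN : M * N = 0)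
    (hr : Fintype.card n ≤ M.rank + N.rank) (z : n → K) (hz : M *ᵥ z = 0) : ∃ y, N *ᵥ y = z := by
  classical
  have h1 := LinearMap.finrank_range_add_finrank_ker M.mulVecLin
  rw [Module.finrank_fintype_fun_eq_card] at h1
  have hle : LinearMap.range N.mulVecLin ≤ LinearMap.ker M.mulVecLin := by
    rintro _ ⟨y, rfl⟩
    simp [Matrix.mulVec_mulVec, hMN]
  have heq := Submodule.eq_of_le_of_finrank_le hle (by
    rw [Matrix.rank, Matrix.rank] at hr
    omega)
  have hz' : z ∈ LinearMap.ker M.mulVecLin := by simpa using hz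
  rw [← heq] at hz'
  obtain ⟨y, hy⟩ := hz'
  exact ⟨y, by simpa using hy⟩

/-- The dimension count from exactness of the dual complex. -/
lemma Matrix.card_le_rank_add_rank_of_exact [Fintype m] [Fintype k] (M : Matrix m n K) (N : Matrix n k K)
    (h : ∀ z, Nᵀ *ᵥ z = 0 → ∃ y, Mᵀ *ᵥ y = z) : Fintype.card n ≤ M.rank + N.rank := by
  classical
  have h1 := LinearMap.finrank_range_add_finrank_ker Nᵀ.mulVecLin
  rw [Module.finrank_fintype_fun_eq_card] at h1
  have hle : LinearMap.ker Nᵀ.mulVecLin ≤ LinearMap.range Mᵀ.mulVecLin := by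
    intro z hz
    obtain ⟨y, hy⟩ := h z (by rwa [LinearMap.mem_ker, Matrix.mulVecLin_apply] at hz)
    exact ⟨y, by rw [Matrix.mulVecLin_apply, hy]⟩
  have h2 := Submodule.finrank_mono hle
  rw [← Matrix.rank_transpose M, ← Matrix.rank_transpose N, Matrix.rank, Matrix.rank]
  omega

end LinearAlgebra

/-! ### Simplicial homology mod 2 of induced subcomplexes. -/

section Homology

open Matrix

variable {V : Type*} [DecidableEq V]

/-- The edges of `T` inside `A`. -/
def edgesIn (T : Finset (Finset V)) (A : Finset V) : Finset (Finset V) :=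
  (triEdges T).filter (· ⊆ A)

/-- The triangles of `T` inside `A`. -/
def trisIn (T : Finset (Finset V)) (A : Finset V) : Finset (Finset V) := T.filter (· ⊆ A)

lemma edgesIn_triVerts (T : Finset (Finset V)) : edgesIn T (triVerts T) = triEdges T := by
  rw [edgesIn, Finset.filter_eq_self]
  intro e he
  obtain ⟨_, t, ht, het⟩ := mem_triEdges.1 he
  exact het.trans (subset_triVerts ht)

lemma trisIn_triVerts (T : Finset (Finset V)) : trisIn T (triVerts T) = T := by
  rw [trisIn, Finset.filter_eq_self]
  exact fun t ht => subset_triVerts ht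

/-- The boundary matrix from edges to vertices. -/
def bdryOne (T : Finset (Finset V)) (A : Finset V) : Matrix A (edgesIn T A) (ZMod 2) :=
  fun v e => if v.1 ∈ e.1 then 1 else 0

/-- The boundary matrix from triangles to edges. -/
def bdryTwo (T : Finset (Finset V)) (A : Finset V) :
    Matrix (edgesIn T A) (trisIn T A) (ZMod 2) :=
  fun e t => if e.1 ⊆ t.1 then 1 else 0

lemma bdryOne_transpose_mulVec (T : Finset (Finset V)) (A : Finset V) (x : V → ZMod 2)
    (e : edgesIn T A) : ((bdryOne T A)ᵀ *ᵥ fun v => x v) e = ∑ v ∈ e.1, x v := by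
  have he : e.1 ⊆ A := (Finset.mem_filter.1 e.2).2
  simp only [mulVec, dotProduct, transpose_apply, bdryOne, ite_mul, one_mul, zero_mul]
  rw [Finset.sum_coe_sort A (fun v => if v ∈ e.1 then x v else 0), ← Finset.sum_filter,
    Finset.filter_mem_eq_inter, Finset.inter_eq_right.2 he]

lemma bdryTwo_mulVec (T : Finset (Finset V)) (A : Finset V) (y : Finset V → ZMod 2)
    (e : edgesIn T A) : (bdryTwo T A *ᵥ fun t => y t) e =
      ∑ t ∈ (trisIn T A).filter (e.1 ⊆ ·), y t := by
  simp only [mulVec, dotProduct, bdryTwo, ite_mul, one_mul, zero_mul]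
  rw [Finset.sum_coe_sort (trisIn T A) (fun t => if e.1 ⊆ t then y t else 0), Finset.sum_filter]

lemma bdryTwo_transpose_mulVec (T : Finset (Finset V)) (A : Finset V) (z : Finset V → ZMod 2)
    (t : trisIn T A) : ((bdryTwo T A)ᵀ *ᵥ fun e => z e) t =
      ∑ e ∈ t.1.powersetCard 2, z e := by
  simp only [mulVec, dotProduct, transpose_apply, bdryTwo, ite_mul, one_mul, zero_mul]
  rw [Finset.sum_coe_sort (edgesIn T A) (fun e => if e ⊆ t.1 then z e else 0), ← Finset.sum_filter]
  congr 1
  have ht := Finset.mem_filter.1 t.2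
  ext e
  simp only [Finset.mem_filter, edgesIn, mem_triEdges, Finset.mem_powersetCard]
  constructor
  · rintro ⟨⟨⟨h1, _⟩, _⟩, h2⟩; exact ⟨h2, h1⟩
  · rintro ⟨h2, h1⟩; exact ⟨⟨⟨h1, t, ht.1, h2⟩, h2.trans ht.2⟩, h2⟩

lemma bdryOne_mulVec (T : Finset (Finset V)) (A : Finset V) (z : Finset V → ZMod 2) (v : A) :
    (bdryOne T A *ᵥ fun e => z e) v = ∑ e ∈ (edgesIn T A).filter (v.1 ∈ ·), z e := by
  simp only [mulVec, dotProduct, bdryOne, ite_mul, one_mul, zero_mul]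
  rw [Finset.sum_coe_sort (edgesIn T A) (fun e => if v.1 ∈ e then z e else 0), Finset.sum_filter]

/-- Every function on a finite set of elements extends to the whole type. -/
lemma exists_extend {α β : Type*} [Zero β] {s : Finset α} (x : s → β) :
    ∃ y : α → β, x = fun v : s => y v := by
  classical
  exact ⟨fun v => if h : v ∈ s then x ⟨v, h⟩ else 0, by ext v; simp⟩

namespace IsSurface

variable {T : Finset (Finset V)}

/-- Each vertex of a triangle lies on exactly two of its three edges, and 2 = 0. The transpose is
computed, since there the product is a coboundary evaluated on a triangle. -/
lemma bdryOne_mul_bdryTwo (hT : IsSurface T) (A : Finset V) : bdryOne T A * bdryTwo T A = 0 := by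
  suffices (bdryTwo T A)ᵀ * (bdryOne T A)ᵀ = 0 by
    rw [← Matrix.transpose_mul] at this
    simpa using congrArg Matrix.transpose this
  ext t v
  refine (bdryTwo_transpose_mulVec T A
    (fun e : Finset V => if v.1 ∈ e then (1 : ZMod 2) else 0) t).trans ?_
  have ht := hT.card_eq t.1 (Finset.mem_filter.1 t.2).1
  obtain ⟨a, b, c, hab, hac, hbc, habc⟩ := Finset.card_eq_three.1 ht
  rw [← Finset.sum_filter, Finset.sum_const, nsmul_one, Matrix.zero_apply]
  by_cases hv : v.1 ∈ t.1
  · have : (t.1.powersetCard 2).filter (v.1 ∈ ·) = ((t.1.erase v.1).powersetCard 1).image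
        (insert v.1) := by
      ext e
      simp only [Finset.mem_filter, Finset.mem_powersetCard, Finset.mem_image]
      constructor
      · rintro ⟨⟨h1, h2⟩, h3⟩
        refine ⟨e.erase v.1, ⟨Finset.erase_subset_erase _ h1, ?_⟩, Finset.insert_erase h3⟩
        rw [Finset.card_erase_of_mem h3, h2]
      · rintro ⟨s, ⟨h1, h2⟩, rfl⟩
        have hs : v.1 ∉ s := fun h => by simpa using h1 h
        refine ⟨⟨Finset.insert_subset hv (h1.trans (Finset.erase_subset _ _)), ?_⟩, by simp⟩
        rw [Finset.card_insert_of_notMem hs, h2]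
    rw [this, Finset.card_image_of_injOn, Finset.card_powersetCard, Finset.card_erase_of_mem hv, ht]
    · decide
    · intro s hs s' hs' h
      simp only [Finset.mem_coe,
        Finset.mem_powersetCard] at hs hs'
      have h1 : v.1 ∉ s := fun h => by simpa using hs.1 h
      have h2 : v.1 ∉ s' := fun h => by simpa using hs'.1 h
      rw [← Finset.erase_insert h1, ← Finset.erase_insert h2]
      exact congrArg (Finset.erase · v.1) h
  · rw [Finset.filter_eq_empty_iff.2]
    · simp
    · intro e he h
      exact hv ((Finset.mem_powersetCard.1 he).1 h)

/-- A 0-cocycle has equal values at the two ends of an edge, so it is constant once the graph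
induced on `A` is connected. `hconn` expresses this connectedness as the propagation of every
predicate along edges. -/
lemma card_le_rank_bdryOne (A : Finset V)
    (hconn : ∀ h : V → Prop, (∀ e ∈ triEdges T, e ⊆ A → ∀ u ∈ e, ∀ w ∈ e, h u → h w) →
      ∀ u ∈ A, ∀ w ∈ A, h u → h w) : A.card ≤ (bdryOne T A).rank + 1 := by
  rw [← Matrix.rank_transpose]
  have := Matrix.card_le_rank_add_one_of_ker (bdryOne T A)ᵀ (by
    intro x hx i j
    obtain ⟨y, rfl⟩ := exists_extend x
    have key : ∀ e ∈ triEdges T, e ⊆ A → ∀ u ∈ e, ∀ w ∈ e, y u = y w := by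
      intro e he heA u hu w hw
      have h0 := congrFun hx ⟨e, Finset.mem_filter.2 ⟨he, heA⟩⟩
      rw [bdryOne_transpose_mulVec] at h0
      obtain ⟨p, q, hpq, rfl⟩ := Finset.card_eq_two.1 (mem_triEdges.1 he).1
      rw [Finset.sum_pair hpq] at h0
      have h1 : y p = y q := by
        rw [Pi.zero_apply] at h0
        exact CharTwo.add_eq_zero.1 h0
      simp only [Finset.mem_insert, Finset.mem_singleton] at hu hw
      rcases hu with rfl | rfl <;> rcases hw with rfl | rfl <;> simp [h1]
    have := hconn (fun v => y v = y i.1) (fun e he heA u hu w hw h => by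
      rw [← h]; exact key e he heA w hw u hu) i.1 i.2 j.1 j.2 rfl
    exact this.symm)
  simpa using this

lemma rank_bdryOne_add_one_le (A : Finset V) (hA : A.Nonempty) :
    (bdryOne T A).rank + 1 ≤ A.card := by
  rw [← Matrix.rank_transpose]
  have : Nonempty A := hA.to_subtype
  have := Matrix.rank_add_one_le_of_mulVec_one (bdryOne T A)ᵀ (by
    ext e
    have h := bdryOne_transpose_mulVec T A (fun _ => 1) e
    have he := mem_triEdges.1 (Finset.mem_filter.1 e.2).1
    rw [Finset.sum_const, he.1] at h
    exact h.trans (show (2 • 1 : ZMod 2) = 0 by decide))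
  simpa using this

/-- Cycles of triangles are everything or nothing. -/
lemma const_of_bdryTwo (hT : IsSurface T) (A : Finset V) (y : Finset V → ZMod 2)
    (hy : ∀ t ∈ T, ¬ t ⊆ A → y t = 0) (h0 : (bdryTwo T A *ᵥ fun t => y t) = 0) :
    ∀ s ∈ T, ∀ t ∈ T, y s = y t := by
  have key : ∀ s ∈ T, ∀ t ∈ T, (s ∩ t).card = 2 → y s = y t := by
    intro s hs t ht hst
    obtain ⟨t', ht', hne, hsub, hall⟩ := hT.exists_other hs hst Finset.inter_subset_left
    have htt : t = t' := by
      rcases hall t ht Finset.inter_subset_right with h | h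
      · subst h
        rw [Finset.inter_self, hT.card_eq _ ht] at hst
        omega
      · exact h
    subst htt
    -- If the common edge lies in `A`, the cycle condition on it reads `y s + y t = 0`, where a
    -- triangle leaving `A` contributes zero by `hy`. If it does not, both triangles leave `A`.
    by_cases hA : s ∩ t ⊆ A
    · have h := congrFun h0 ⟨s ∩ t, Finset.mem_filter.2
        ⟨mem_triEdges.2 ⟨hst, s, hs, Finset.inter_subset_left⟩, hA⟩⟩
      rw [bdryTwo_mulVec] at h
      have h2 : ∑ u ∈ (trisIn T A).filter (s ∩ t ⊆ ·), y u = ∑ u ∈ ({s, t} : Finset _), y u := by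
        apply Finset.sum_subset
        · intro u hu
          simp only [trisIn, Finset.mem_filter] at hu
          simpa using hall u hu.1.1 hu.2
        · intro u hu hu'
          simp only [trisIn, Finset.mem_filter, not_and] at hu'
          simp only [Finset.mem_insert, Finset.mem_singleton] at hu
          rcases hu with rfl | rfl
          · exact hy _ hs fun h => hu' ⟨hs, h⟩ Finset.inter_subset_left
          · exact hy _ ht fun h => hu' ⟨ht, h⟩ Finset.inter_subset_right
      rw [h2, Finset.sum_pair hne.symm] at h
      exact CharTwo.add_eq_zero.1 h
    · rw [hy s hs fun h => hA (Finset.inter_subset_left.trans h),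
        hy t ht fun h => hA (Finset.inter_subset_right.trans h)]
  intro s hs t ht
  exact (hT.conn ∅ (by simp) (fun u => y u = y s)
    (fun a ha b hb _ _ hab h => by rw [← key a ha b hb hab]; exact h) s hs t ht
    (by simp) (by simp) rfl).symm

/-- A 2-cycle of the subcomplex, extended by zero, is constant on all of `T` and vanishes at a
triangle that is not inside `A`; so the boundary map is injective. -/
lemma rank_bdryTwo_of_not_subset (hT : IsSurface T) (A : Finset V) (hA : ∃ t ∈ T, ¬ t ⊆ A) :
    (bdryTwo T A).rank = (trisIn T A).card := by
  have := Matrix.rank_eq_card_of_ker (bdryTwo T A) (by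
    intro x hx
    obtain ⟨y, rfl⟩ := exists_extend x
    obtain ⟨t₀, ht₀, hn⟩ := hA
    let y' : Finset V → ZMod 2 := fun t => if t ⊆ A then y t else 0
    have hyy : (fun t : trisIn T A => y t) = fun t : trisIn T A => y' t := by
      ext t
      simp [y', (Finset.mem_filter.1 t.2).2]
    rw [hyy] at hx ⊢
    have h := hT.const_of_bdryTwo A y' (fun t _ h => by simp [y', h]) hx
    ext t
    rw [h t (Finset.mem_filter.1 t.2).1 t₀ ht₀]
    simp [y', hn])
  simpa using this

/-- The sum of all triangles is a cycle because each edge lies in two of them, and it is the only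
nonzero cycle. -/
lemma rank_bdryTwo_add_one (hT : IsSurface T) (hne : T.Nonempty) :
    (bdryTwo T (triVerts T)).rank + 1 = T.card := by
  apply le_antisymm
  · have : Nonempty (trisIn T (triVerts T)) := by
      rw [trisIn_triVerts]
      exact hne.to_subtype
    have := Matrix.rank_add_one_le_of_mulVec_one (bdryTwo T (triVerts T)) (by
      ext e
      have h := bdryTwo_mulVec T (triVerts T) (fun _ => 1) e
      have he := mem_triEdges.1 (Finset.mem_filter.1 e.2).1
      refine h.trans ?_
      rw [trisIn_triVerts, Finset.sum_const, hT.card_filter e.1 he.1 he.2]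
      exact (show (2 • 1 : ZMod 2) = 0 by decide))
    simpa [trisIn_triVerts] using this
  · have := Matrix.card_le_rank_add_one_of_ker (bdryTwo T (triVerts T)) (by
      intro x hx i j
      obtain ⟨y, rfl⟩ := exists_extend x
      exact hT.const_of_bdryTwo _ y (fun t ht h => absurd (subset_triVerts ht) h) hx _
        (Finset.mem_filter.1 i.2).1 _ (Finset.mem_filter.1 j.2).1)
    simpa [trisIn_triVerts] using this

/-- The Euler characteristic of a proper connected subcomplex is at most one. -/
lemma card_add_card_le (hT : IsSurface T) (A : Finset V) (hA : ∃ t ∈ T, ¬ t ⊆ A)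
    (hconn : ∀ h : V → Prop, (∀ e ∈ triEdges T, e ⊆ A → ∀ u ∈ e, ∀ w ∈ e, h u → h w) →
      ∀ u ∈ A, ∀ w ∈ A, h u → h w) :
    (trisIn T A).card + A.card ≤ (edgesIn T A).card + 1 := by
  -- In terms of mod 2 Betti numbers of the induced subcomplex: b₀ ≤ 1 from `h1`, b₂ = 0 from `h2`,
  -- b₁ ≥ 0 from `h3`.
  have h1 := card_le_rank_bdryOne (T := T) A hconn
  have h2 := hT.rank_bdryTwo_of_not_subset A hA
  have h3 := Matrix.rank_add_rank_le_card_of_mul_eq_zero (hT.bdryOne_mul_bdryTwo A)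
  rw [Fintype.card_coe] at h3
  omega

/-- A surface is connected as a graph. -/
lemma vert_conn (hT : IsSurface T) (h : V → Prop)
    (hh : ∀ e ∈ triEdges T, ∀ u ∈ e, ∀ w ∈ e, h u → h w) :
    ∀ u ∈ triVerts T, ∀ w ∈ triVerts T, h u → h w := by
  have key : ∀ t ∈ T, ∀ u ∈ t, ∀ w ∈ t, h u → h w := by
    intro t ht u hu w hw h1
    by_cases huw : u = w
    · rwa [← huw]
    · exact hh {u, w} (mem_triEdges.2 ⟨Finset.card_pair huw, t, ht, by
        intro x; simp; rintro (rfl | rfl) <;> assumption⟩) u (by simp) w (by simp) h1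
  intro u hu w hw h1
  obtain ⟨s, hs, hus⟩ := mem_triVerts.1 hu
  obtain ⟨t, ht, hwt⟩ := mem_triVerts.1 hw
  have h2 := hT.conn ∅ (by simp) (fun t => ∃ v ∈ t, h v) (by
    rintro a ha b hb _ _ hab ⟨v, hv, h1⟩
    obtain ⟨x, hx⟩ := Finset.card_pos.1 (by omega : 0 < (a ∩ b).card)
    rw [Finset.mem_inter] at hx
    exact ⟨x, hx.2, key a ha v hv x hx.1 h1⟩) s hs t ht (by simp) (by simp) ⟨u, hus, h1⟩
  obtain ⟨v, hv, h3⟩ := h2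
  exact key t ht v hv w hwt h3

lemma rank_bdryOne_add_one (hT : IsSurface T) (hne : T.Nonempty) :
    (bdryOne T (triVerts T)).rank + 1 = (triVerts T).card := by
  apply le_antisymm
  · apply rank_bdryOne_add_one_le
    obtain ⟨t, ht⟩ := hne
    obtain ⟨v, hv⟩ := Finset.card_pos.1 (by rw [hT.card_eq t ht]; omega : 0 < t.card)
    exact ⟨v, mem_triVerts.2 ⟨t, ht, hv⟩⟩
  · apply card_le_rank_bdryOne
    intro h hh
    exact hT.vert_conn h fun e he => hh e he (by
      obtain ⟨_, t, ht, het⟩ := mem_triEdges.1 he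
      exact het.trans (subset_triVerts ht))

/-- If the Euler characteristic is two, every one-dimensional cycle bounds. -/
lemma exists_bdry (hT : IsSurface T) (hne : T.Nonempty)
    (hχ : T.card + 4 = 2 * (triVerts T).card) (z : Finset V → ZMod 2)
    (hz : ∀ v ∈ triVerts T, ∑ e ∈ (triEdges T).filter (v ∈ ·), z e = 0) :
    ∃ y : Finset V → ZMod 2, ∀ e ∈ triEdges T, ∑ t ∈ T.filter (e ⊆ ·), y t = z e := by
  have h1 := hT.rank_bdryOne_add_one hne
  have h2 := hT.rank_bdryTwo_add_one hne
  have h3 := hT.two_mul_card_edges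
  -- The two ranks add up to (f₀ - 1) + (f₂ - 1), which equals f₁ by `hχ` and 2f₁ = 3f₂; hence the
  -- complex is exact at the edges.
  obtain ⟨x, hx⟩ := Matrix.exists_mulVec_eq_of_rank _ _ (hT.bdryOne_mul_bdryTwo (triVerts T))
    (by
      have h4 := congrArg Finset.card (edgesIn_triVerts T)
      rw [Fintype.card_coe]
      omega) (fun e => z e) (by
      ext v
      rw [bdryOne_mulVec, edgesIn_triVerts]
      exact hz v v.2)
  obtain ⟨y, rfl⟩ := exists_extend x
  refine ⟨y, fun e he => ?_⟩
  have := congrFun hx ⟨e, by rwa [edgesIn_triVerts]⟩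
  rwa [bdryTwo_mulVec, trisIn_triVerts] at this

/-- If every one-dimensional cocycle is a coboundary, the Euler characteristic is two. -/
lemma card_eq_of_cocycles (hT : IsSurface T) (hne : T.Nonempty)
    (hco : ∀ z : Finset V → ZMod 2, (∀ t ∈ T, ∑ e ∈ t.powersetCard 2, z e = 0) →
      ∃ y : V → ZMod 2, ∀ e ∈ triEdges T, z e = ∑ v ∈ e, y v) :
    T.card + 4 = 2 * (triVerts T).card := by
  have h1 := hT.rank_bdryOne_add_one hne
  have h2 := hT.rank_bdryTwo_add_one hne
  have h3 := hT.two_mul_card_edges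
  -- `h4` and `h5` together give f₁ = (f₀ - 1) + (f₂ - 1); with 2f₁ = 3f₂ this is the claim.
  have h4 := Matrix.rank_add_rank_le_card_of_mul_eq_zero (hT.bdryOne_mul_bdryTwo (triVerts T))
  have h5 := Matrix.card_le_rank_add_rank_of_exact (bdryOne T (triVerts T))
    (bdryTwo T (triVerts T)) (by
      intro x hx
      obtain ⟨z, rfl⟩ := exists_extend x
      obtain ⟨y, hy⟩ := hco z (fun t ht => by
        have := congrFun hx ⟨t, by rwa [trisIn_triVerts]⟩
        rwa [bdryTwo_transpose_mulVec] at this)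
      refine ⟨fun v => y v, ?_⟩
      ext e
      rw [bdryOne_transpose_mulVec]
      exact (hy e (Finset.mem_filter.1 e.2).1).symm)
  have h6 := congrArg Finset.card (edgesIn_triVerts T)
  rw [Fintype.card_coe] at h4 h5
  omega

end IsSurface

end Homology

/-! ### The rigidity inequality. -/

section Rigidity

variable {V : Type*} [DecidableEq V]

/-- The edges of `T` meeting `A`. -/
def edgesMeeting (T : Finset (Finset V)) (A : Finset V) : Finset (Finset V) :=
  (triEdges T).filter (fun e => ∃ v ∈ e, v ∈ A)

namespace IsSurface

variable {T : Finset (Finset V)}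

lemma two_mul_card_filter_edges (hT : IsSurface T) (P : Finset V → Prop) [DecidablePred P] :
    2 * ((triEdges T).filter P).card = ∑ t ∈ T, ((t.powersetCard 2).filter P).card := by
  have h := Finset.sum_card_bipartiteAbove_eq_sum_card_bipartiteBelow
    (s := (triEdges T).filter P) (t := T) (fun e t => e ⊆ t)
  have h1 : ∑ e ∈ (triEdges T).filter P, (Finset.bipartiteAbove (fun e t => e ⊆ t) T e).card
      = ((triEdges T).filter P).card * 2 := by
    apply Finset.sum_const_nat
    intro e he
    rw [Finset.mem_filter, mem_triEdges] at he
    exact hT.card_filter e he.1.1 he.1.2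
  rw [mul_comm, ← h1, h]
  refine Finset.sum_congr rfl fun t ht => ?_
  congr 1
  ext e
  simp only [Finset.mem_bipartiteBelow, Finset.mem_filter, mem_triEdges, Finset.mem_powersetCard]
  constructor
  · rintro ⟨⟨⟨h1, _⟩, h2⟩, h3⟩; exact ⟨⟨h3, h1⟩, h2⟩
  · rintro ⟨⟨h3, h1⟩, h2⟩; exact ⟨⟨⟨h1, t, ht, h3⟩, h2⟩, h3⟩

lemma card_filter_powersetCard_subset (t A : Finset V) :
    ((t.powersetCard 2).filter (· ⊆ A)).card = (t ∩ A).card.choose 2 := by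
  rw [← Finset.card_powersetCard]
  congr 1
  ext e
  simp only [Finset.mem_filter, Finset.mem_powersetCard, Finset.subset_inter_iff]
  tauto

lemma card_filter_powersetCard_meeting (t A : Finset V) :
    ((t.powersetCard 2).filter (fun e => ∃ v ∈ e, v ∈ A)).card + (t \ A).card.choose 2 =
      t.card.choose 2 := by
  rw [← Finset.card_powersetCard, ← Finset.card_powersetCard, ← Finset.card_union_of_disjoint]
  · congr 1
    ext e
    simp only [Finset.mem_union, Finset.mem_filter, Finset.mem_powersetCard, Finset.subset_sdiff,
      Finset.disjoint_left]
    constructor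
    · rintro (h | h)
      · exact h.1
      · exact ⟨h.1.1, h.2⟩
    · intro h
      by_cases h' : ∃ v ∈ e, v ∈ A
      · exact Or.inl ⟨h, h'⟩
      · push Not at h'
        exact Or.inr ⟨⟨h.1, fun v => h' v⟩, h.2⟩
  · rw [Finset.disjoint_left]
    intro e he he'
    simp only [Finset.mem_filter, Finset.mem_powersetCard, Finset.subset_sdiff,
      Finset.disjoint_left] at he he'
    obtain ⟨_, v, hv, hvA⟩ := he
    exact he'.1.2 hv hvA

/-- Both edge counts are half of sums over triangles, so one triangle with k vertices in `A` can be
checked at a time: for k = 0, 1, 2, 3 it has 0, 2, 3, 3 edges meeting `A` and 0, 0, 1, 3 edges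
inside `A`. -/
lemma two_mul_card_meeting (hT : IsSurface T) (A : Finset V) :
    2 * (edgesMeeting T A).card + 6 * (trisIn T A).card =
      6 * (edgesIn T A).card + 2 * (T.filter (fun t => (t ∩ A).card = 1)).card := by
  have h1 := hT.two_mul_card_filter_edges (fun e => ∃ v ∈ e, v ∈ A)
  have h2 := hT.two_mul_card_filter_edges (· ⊆ A)
  rw [edgesMeeting, h1, edgesIn, show 6 = 3 * 2 by rfl, mul_assoc 3 2 (Finset.card (Finset.filter
    _ (triEdges T))), h2, trisIn, Finset.card_filter, Finset.card_filter, Finset.mul_sum,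
    Finset.mul_sum, Finset.mul_sum, ← Finset.sum_add_distrib, ← Finset.sum_add_distrib]
  refine Finset.sum_congr rfl fun t ht => ?_
  have h3 := card_filter_powersetCard_meeting t A
  have h4 := Finset.card_sdiff_add_card_inter t A
  have ht3 := hT.card_eq t ht
  have hA : t ⊆ A ↔ (t ∩ A).card = 3 := by
    rw [← Finset.inter_eq_left]
    constructor
    · intro h; rw [h, ht3]
    · intro h; exact Finset.eq_of_subset_of_card_le Finset.inter_subset_left (by omega)
  rw [card_filter_powersetCard_subset]
  simp only [hA]
  rw [ht3] at h3 h4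
  generalize (t ∩ A).card = k at *
  have hk : (t \ A).card = 3 - k := by omega
  rw [hk] at h3
  have hk3 : k ≤ 3 := by omega
  generalize (Finset.filter (fun e => ∃ v ∈ e, v ∈ A) (Finset.powersetCard 2 t)).card = m at *
  interval_cases k <;> simp [Nat.choose] at h3 ⊢ <;> omega

/-- In the link of `b`, these are the link edges with exactly one end in `A`. Count the pairs of a
vertex x of `A` and a triangle containing b and x: each x contributes 0 or 2, and each triangle
through b contributes at most 2 because b is not in `A`. -/
lemma even_card_filter_one (hT : IsSurface T) {A : Finset V} {b : V} (hb : b ∉ A) :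
    Even (T.filter (fun t => (t ∩ A).card = 1 ∧ b ∈ t)).card := by
  have h := Finset.sum_card_bipartiteAbove_eq_sum_card_bipartiteBelow
    (s := A) (t := T.filter (b ∈ ·)) (fun x t => x ∈ t)
  have h1 : Even (∑ x ∈ A, (Finset.bipartiteAbove (fun x t => x ∈ t) (T.filter (b ∈ ·)) x).card) := by
    apply Finset.even_sum
    intro x hx
    have hxb : b ≠ x := fun h => hb (h ▸ hx)
    have : Finset.bipartiteAbove (fun x t => x ∈ t) (T.filter (b ∈ ·)) x =
        T.filter (({b, x} : Finset V) ⊆ ·) := by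
      ext t
      simp [Finset.bipartiteAbove, Finset.insert_subset_iff, and_assoc]
    rw [this]
    by_cases hex : ∃ t ∈ T, {b, x} ⊆ t
    · rw [hT.card_filter _ (Finset.card_pair hxb) hex]
      exact even_two
    · push Not at hex
      rw [Finset.filter_eq_empty_iff.2 hex]
      simp
  rw [h] at h1
  have h2 : (T.filter (fun t => (t ∩ A).card = 1 ∧ b ∈ t)).card +
      2 * (T.filter (fun t => (t ∩ A).card = 2 ∧ b ∈ t)).card =
      ∑ t ∈ T.filter (b ∈ ·), (Finset.bipartiteBelow (fun x t => x ∈ t) A t).card := by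
    rw [Finset.card_filter, Finset.card_filter, Finset.mul_sum, Finset.sum_filter,
      ← Finset.sum_add_distrib]
    refine Finset.sum_congr rfl fun t ht => ?_
    by_cases hbt : b ∈ t
    · have : Finset.bipartiteBelow (fun x t => x ∈ t) A t = t ∩ A := by
        ext x; simp [Finset.bipartiteBelow, and_comm]
      rw [this]
      have hlt : (t ∩ A).card < t.card := Finset.card_lt_card
        ⟨Finset.inter_subset_left, fun h => hb (Finset.mem_inter.1 (h hbt)).2⟩
      rw [hT.card_eq t ht] at hlt
      generalize (t ∩ A).card = k at *
      interval_cases k <;> simp [hbt]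
    · simp [hbt]
  rw [← h2] at h1
  rw [Nat.even_add] at h1
  exact h1.2 (even_two_mul _)

/-- Somewhere a triangle s missing `A` shares an edge bc with a triangle having one vertex in `A`.
By parity at b and at c, if there were fewer than three triangles of the latter kind, there would be
exactly two and both would contain bc. They would be all the triangles on bc, leaving no room for s.
-/
lemma three_le_card_filter_one (hT : IsSurface T) {A σ : Finset V} (hσ : σ ∈ T)
    (hAσ : Disjoint A σ) {v : V} (hv : v ∈ A) (hvT : v ∈ triVerts T) :
    3 ≤ (T.filter (fun t => (t ∩ A).card = 1)).card := by
  have zero_iff : ∀ t : Finset V, (t ∩ A).card = 0 ↔ Disjoint t A := fun t => by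
    rw [Finset.card_eq_zero, Finset.disjoint_iff_inter_eq_empty]
  have le_one : ∀ s ∈ T, ∀ t ∈ T, (s ∩ t).card = 2 → (s ∩ A).card = 0 → (t ∩ A).card ≤ 1 := by
    intro s hs t ht hst h0
    have hsub : t ∩ A ⊆ t \ s := by
      intro x hx
      rw [Finset.mem_inter] at hx
      rw [Finset.mem_sdiff]
      exact ⟨hx.1, fun h => Finset.disjoint_left.1 ((zero_iff s).1 h0) h hx.2⟩
    have h1 := Finset.card_le_card hsub
    have h2 := Finset.card_sdiff_add_card_inter t s
    rw [Finset.inter_comm, hT.card_eq t ht, hst] at h2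
    omega
  -- Otherwise missing `A` would spread from `σ` over the whole connected surface, contradicting
  -- `hvT`.
  obtain ⟨t₀, ht₀, b, hb₀, h0, t₁, ht₁, hb₁, h1⟩ : ∃ t₀ ∈ T, ∃ b ∈ t₀, (t₀ ∩ A).card = 0 ∧
      ∃ t₁ ∈ T, b ∈ t₁ ∧ (t₁ ∩ A).card ≠ 0 := by
    by_contra hcon
    push Not at hcon
    obtain ⟨u, hu, hvu⟩ := mem_triVerts.1 hvT
    have := hT.conn ∅ (by simp) (fun t => (t ∩ A).card = 0) (by
      intro s hs t ht _ _ hst h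
      obtain ⟨x, hx⟩ := Finset.card_pos.1 (by omega : 0 < (s ∩ t).card)
      rw [Finset.mem_inter] at hx
      exact hcon s hs x hx.1 h t ht hx.2) σ hσ u hu (by simp) (by simp)
      ((zero_iff σ).2 hAσ.symm)
    exact Finset.disjoint_left.1 ((zero_iff u).1 this) hvu hv
  have hbA : b ∉ A := Finset.disjoint_left.1 ((zero_iff t₀).1 h0) hb₀
  by_contra hlt
  have hconn : ∀ (_ : ∀ s ∈ T, ∀ t ∈ T, b ∈ s → b ∈ t → (s ∩ t).card = 2 → (s ∩ A).card = 0 →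
      (t ∩ A).card ≠ 1), False := by
    intro h
    refine h1 (hT.conn {b} (by simp) (fun t => (t ∩ A).card = 0) ?_ t₀ ht₀ t₁ ht₁ (by simpa)
      (by simpa) h0)
    intro s hs t ht hbs hbt hst h2
    have h3 := le_one s hs t ht hst h2
    have h4 := h s hs t ht (by simpa using hbs) (by simpa using hbt) hst h2
    omega
  -- The count at `c` is even and positive, so at least 2; by `hlt` it already exhausts all
  -- triangles with one vertex in `A`.
  have hfil : ∀ c ∉ A, ∀ s ∈ T, c ∈ s → (s ∩ A).card = 1 →
      T.filter (fun t => (t ∩ A).card = 1 ∧ c ∈ t) = T.filter (fun t => (t ∩ A).card = 1) ∧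
      2 ≤ (T.filter (fun t => (t ∩ A).card = 1 ∧ c ∈ t)).card := by
    intro c hc s hs hcs hs1
    have hpos : 0 < (T.filter (fun t => (t ∩ A).card = 1 ∧ c ∈ t)).card :=
      Finset.card_pos.2 ⟨s, Finset.mem_filter.2 ⟨hs, hs1, hcs⟩⟩
    obtain ⟨k, hk⟩ := hT.even_card_filter_one (A := A) hc
    have h2 : 2 ≤ (T.filter (fun t => (t ∩ A).card = 1 ∧ c ∈ t)).card := by omega
    refine ⟨Finset.eq_of_subset_of_card_le ?_ (by omega), h2⟩
    intro t
    simp only [Finset.mem_filter]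
    tauto
  apply hconn
  intro s hs t ht hbs hbt hst hs0 ht1
  obtain ⟨hf, h2⟩ := hfil b hbA t ht hbt ht1
  have hst' : ∃ c ∈ s ∩ t, c ≠ b := Finset.exists_mem_ne (by omega) b
  obtain ⟨c, hc, hcb⟩ := hst'
  rw [Finset.mem_inter] at hc
  have hcA : c ∉ A := Finset.disjoint_left.1 ((zero_iff s).1 hs0) hc.1
  obtain ⟨hg, _⟩ := hfil c hcA t ht hc.2 ht1
  have hsub : T.filter (fun t => (t ∩ A).card = 1) ⊆ T.filter (({b, c} : Finset V) ⊆ ·) := by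
    intro u hu
    have h3 := hu
    have h4 := hu
    rw [← hf] at h3
    rw [← hg] at h4
    simp only [Finset.mem_filter] at h3 h4 ⊢
    exact ⟨h3.1, by simp [Finset.insert_subset_iff, h3.2.2, h4.2.2]⟩
  have hbcs : ({b, c} : Finset V) ⊆ s := by simp [Finset.insert_subset_iff, hbs, hc.1]
  have heq := Finset.eq_of_subset_of_card_le hsub (by
    rw [hT.card_filter _ (Finset.card_pair hcb.symm) ⟨s, hs, hbcs⟩, ← hf]
    exact h2)
  have hs1 : s ∈ T.filter (fun t => (t ∩ A).card = 1) := by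
    rw [heq]
    exact Finset.mem_filter.2 ⟨hs, hbcs⟩
  rw [Finset.mem_filter] at hs1
  omega

/-- Gromov's rigidity inequality for surfaces. -/
theorem rigid (hT : IsSurface T) {σ : Finset V} (hσ : σ ∈ T) (A : Finset V)
    (hA : A ⊆ triVerts T) (hAσ : Disjoint A σ) : A.card * 3 ≤ (edgesMeeting T A).card := by
  induction A using Finset.strongInduction with
  | H A ih =>
  rcases A.eq_empty_or_nonempty with rfl | ⟨v, hv⟩
  · simp
  by_cases hconn : ∀ h : V → Prop, (∀ e ∈ triEdges T, e ⊆ A → ∀ u ∈ e, ∀ w ∈ e, h u → h w) →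
      ∀ u ∈ A, ∀ w ∈ A, h u → h w
  -- Connected case: with e edges and t triangles inside `A`, the count is 3(e - t) + N ≥ 3(|A| - 1)
  -- + 3.
  · have hσA : ∃ t ∈ T, ¬ t ⊆ A := by
      refine ⟨σ, hσ, fun h => ?_⟩
      have h1 := hAσ.mono_left h
      rw [disjoint_self] at h1
      have := hT.card_eq σ hσ
      rw [h1] at this
      simp at this
    have h1 := hT.card_add_card_le A hσA hconn
    have h2 := hT.three_le_card_filter_one hσ hAσ hv (hA hv)
    have h3 := hT.two_mul_card_meeting A
    omega
  -- Disconnected case: no edge joins the two parts of `A`, so the sets of edges meeting them are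
  -- disjoint and the two inductive bounds add.
  · classical
    push Not at hconn
    obtain ⟨h, hh, u, hu, w, hw, hhu, hhw⟩ := hconn
    have hs1 : A.filter h ⊂ A := (Finset.filter_ssubset).2 ⟨w, hw, hhw⟩
    have hs2 : A.filter (¬ h ·) ⊂ A := (Finset.filter_ssubset).2 ⟨u, hu, by simpa⟩
    have i1 := ih _ hs1 (hs1.1.trans hA) (hAσ.mono_left hs1.1)
    have i2 := ih _ hs2 (hs2.1.trans hA) (hAσ.mono_left hs2.1)
    have hsum := Finset.card_filter_add_card_filter_not (s := A) h
    have hdis : Disjoint (edgesMeeting T (A.filter h)) (edgesMeeting T (A.filter (¬ h ·))) := by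
      rw [Finset.disjoint_left]
      intro e he he'
      simp only [edgesMeeting, Finset.mem_filter] at he he'
      obtain ⟨heT, x, hxe, hxA, hx⟩ := he
      obtain ⟨_, y, hye, hyA, hy⟩ := he'
      have hxy : x ≠ y := fun hxy => hy (hxy ▸ hx)
      have he2 : {x, y} = e := by
        apply Finset.eq_of_subset_of_card_le
        · simp [Finset.insert_subset_iff, hxe, hye]
        · rw [(mem_triEdges.1 heT).1, Finset.card_pair hxy]
      exact hy (hh e heT (by simp [← he2, Finset.insert_subset_iff, hxA, hyA]) x hxe y hye hx)
    have hle : (edgesMeeting T (A.filter h) ∪ edgesMeeting T (A.filter (¬ h ·))).card ≤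
        (edgesMeeting T A).card := by
      apply Finset.card_le_card
      intro e
      simp only [edgesMeeting, Finset.mem_filter, Finset.mem_union]
      rintro (⟨h1, x, h2, h3, _⟩ | ⟨h1, x, h2, h3, _⟩) <;> exact ⟨h1, x, h2, h3⟩
    rw [Finset.card_union_of_disjoint hdis] at hle
    omega

end IsSurface

end Rigidity

/-! ### Geometric realizations under flips and vertex removal; the tetrahedron. -/

section Realization

variable {V : Type*} [DecidableEq V]

/-- The geometric realization of a set of triangles, in barycentric coordinates. -/
def triReal (T : Finset (Finset V)) : Set (V → ℝ) :=
  {f | (∀ v, 0 ≤ f v) ∧ ∃ t ∈ T, (∀ v ∉ t, f v = 0) ∧ ∑ v ∈ t, f v = 1}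

/-- Two continuous maps restricting to mutually inverse bijections between two sets. -/
def homeomorphOfInvOn {X Y : Type*} [TopologicalSpace X] [TopologicalSpace Y] {S : Set X}
    {S' : Set Y} (F : X → Y) (G : Y → X) (hF : Continuous F) (hG : Continuous G)
    (h1 : ∀ x ∈ S, F x ∈ S') (h2 : ∀ y ∈ S', G y ∈ S) (h3 : ∀ x ∈ S, G (F x) = x)
    (h4 : ∀ y ∈ S', F (G y) = y) : S ≃ₜ S' where
  toFun x := ⟨F x, h1 x x.2⟩
  invFun y := ⟨G y, h2 y y.2⟩
  left_inv x := Subtype.ext (h3 x x.2)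
  right_inv y := Subtype.ext (h4 y y.2)
  continuous_toFun := by fun_prop
  continuous_invFun := by fun_prop

/-- The piecewise linear map exchanging the diagonals `vb` and `ac` of a quadrilateral. -/
def flipMap (v b a c : V) (f : V → ℝ) : V → ℝ := fun x =>
  if x = a ∨ x = c then f x + min (f v) (f b)
  else if x = v ∨ x = b then f x - min (f v) (f b) else f x

lemma continuous_flipMap (v b a c : V) : Continuous (flipMap v b a c) := by
  refine continuous_pi fun x => ?_
  unfold flipMap
  split_ifs <;> fun_prop

/-- The common weight of `v` and `b` is moved to `a` and `c`, preserving the total. Afterwards the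
lighter of `v` and `b` has weight zero, which selects the new triangle. On `R` there is no common
weight and the map is the identity. -/
lemma flipMap_mem {R : Finset (Finset V)} {v b a c : V} (hvb : v ≠ b) (hac : a ≠ c)
    (hva : v ≠ a) (hvc : v ≠ c) (hba : b ≠ a) (hbc : b ≠ c)
    (hR : ∀ t ∈ R, ¬ ({v, b} : Finset V) ⊆ t) {f : V → ℝ}
    (hf : f ∈ triReal (R ∪ {{v, b, a}, {v, b, c}})) :
    flipMap v b a c f ∈ triReal (R ∪ {{a, c, v}, {a, c, b}}) := by
  obtain ⟨h0, t, ht, hout, hsum⟩ := hf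
  refine ⟨fun x => ?_, ?_⟩
  · unfold flipMap
    have := h0 x
    have h1 : 0 ≤ min (f v) (f b) := le_min (h0 v) (h0 b)
    split_ifs with h2 h3
    · linarith
    · rcases h3 with rfl | rfl
      · linarith [min_le_left (f x) (f b)]
      · linarith [min_le_right (f v) (f x)]
    · exact this
  · rcases Finset.mem_union.1 ht with ht | ht
    · have hm : min (f v) (f b) = 0 := by
        have := hR t ht
        simp only [Finset.insert_subset_iff, Finset.singleton_subset_iff, not_and_or] at this
        rcases this with h | h
        · rw [hout v h]; exact min_eq_left (h0 b)
        · rw [hout b h]; exact min_eq_right (h0 v)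
      have : flipMap v b a c f = f := by
        ext x
        simp [flipMap, hm]
      rw [this]
      exact ⟨t, Finset.mem_union_left _ ht, hout, hsum⟩
    · have key : (f v + f b + f a + f c = 1) ∧ ∀ x, x ≠ v → x ≠ b → x ≠ a → x ≠ c → f x = 0 := by
        simp only [Finset.mem_insert, Finset.mem_singleton] at ht
        rcases ht with rfl | rfl
        · rw [Finset.sum_insert (by simp [hvb, hva]), Finset.sum_insert (by simp [hba]),
            Finset.sum_singleton] at hsum
          have hc := hout c (by simp [hvc.symm, hbc.symm, hac.symm])
          exact ⟨by linarith, fun x h1 h2 h3 h4 => hout x (by simp [h1, h2, h3])⟩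
        · rw [Finset.sum_insert (by simp [hvb, hvc]), Finset.sum_insert (by simp [hbc]),
            Finset.sum_singleton] at hsum
          have hc := hout a (by simp [hva.symm, hba.symm, hac])
          exact ⟨by linarith, fun x h1 h2 h3 h4 => hout x (by simp [h1, h2, h4])⟩
      obtain ⟨hs, hz⟩ := key
      rcases le_total (f v) (f b) with hle | hle
      · refine ⟨{a, c, b}, by simp, fun x hx => ?_, ?_⟩
        · simp only [Finset.mem_insert, Finset.mem_singleton, not_or] at hx
          by_cases hxv : x = v
          · subst hxv; simp [flipMap, hva, hvc, hle]
          · simp [flipMap, hx, hxv, hz x hxv hx.2.2 hx.1 hx.2.1]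
        · rw [Finset.sum_insert (by simp [hac, hba.symm]), Finset.sum_insert (by simp [hbc.symm]),
            Finset.sum_singleton]
          simp [flipMap, hba, hbc, hle]
          linarith
      · refine ⟨{a, c, v}, by simp, fun x hx => ?_, ?_⟩
        · simp only [Finset.mem_insert, Finset.mem_singleton, not_or] at hx
          by_cases hxv : x = b
          · subst hxv; simp [flipMap, hba, hbc, hle]
          · simp [flipMap, hx, hxv, hz x hx.2.2 hxv hx.1 hx.2.1]
        · rw [Finset.sum_insert (by simp [hac, hva.symm]), Finset.sum_insert (by simp [hvc.symm]),
            Finset.sum_singleton]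
          simp [flipMap, hva, hvc, hle]
          linarith

/-- Initially `a` or `c` has weight zero, so their common weight after the flip is exactly the
amount that was moved, and the reverse flip returns it. -/
lemma flipMap_flipMap {R : Finset (Finset V)} {v b a c : V} (hac : a ≠ c)
    (hva : v ≠ a) (hvc : v ≠ c) (hba : b ≠ a) (hbc : b ≠ c)
    (hR : ∀ t ∈ R, ¬ ({a, c} : Finset V) ⊆ t) {f : V → ℝ}
    (hf : f ∈ triReal (R ∪ {{v, b, a}, {v, b, c}})) :
    flipMap a c v b (flipMap v b a c f) = f := by
  obtain ⟨h0, t, ht, hout, -⟩ := hf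
  have hm : min (f a) (f c) = 0 := by
    have h : a ∉ t ∨ c ∉ t := by
      rcases Finset.mem_union.1 ht with ht | ht
      · have := hR t ht
        simpa only [Finset.insert_subset_iff, Finset.singleton_subset_iff, not_and_or] using this
      · simp only [Finset.mem_insert, Finset.mem_singleton] at ht
        rcases ht with rfl | rfl
        · right; simp [hvc.symm, hbc.symm, hac.symm]
        · left; simp [hva.symm, hba.symm, hac]
    rcases h with h | h
    · rw [hout a h]; exact min_eq_left (h0 c)
    · rw [hout c h]; exact min_eq_right (h0 a)
  have e1 : flipMap v b a c f a = f a + min (f v) (f b) := by simp [flipMap]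
  have e2 : flipMap v b a c f c = f c + min (f v) (f b) := by simp [flipMap]
  have hm' : min (flipMap v b a c f a) (flipMap v b a c f c) = min (f v) (f b) := by
    rw [e1, e2, min_add_add_right, hm, zero_add]
  ext x
  rw [flipMap, hm']
  by_cases h1 : x = v ∨ x = b
  · have h2 : ¬ (x = a ∨ x = c) := by
      rcases h1 with rfl | rfl <;> simp [*]
    simp [flipMap, h1, h2]
  · by_cases h2 : x = a ∨ x = c
    · simp [flipMap, h1, h2]
    · simp [flipMap, h1, h2]

/-- Exchanging the diagonals of a quadrilateral does not change the realization. -/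
lemma nonempty_homeomorph_flip {R : Finset (Finset V)} {v b a c : V} (hvb : v ≠ b) (hac : a ≠ c)
    (hva : v ≠ a) (hvc : v ≠ c) (hba : b ≠ a) (hbc : b ≠ c)
    (hR : ∀ t ∈ R, ¬ ({v, b} : Finset V) ⊆ t) (hR' : ∀ t ∈ R, ¬ ({a, c} : Finset V) ⊆ t) :
    Nonempty (triReal (R ∪ {{v, b, a}, {v, b, c}}) ≃ₜ triReal (R ∪ {{a, c, v}, {a, c, b}})) :=
  ⟨homeomorphOfInvOn (flipMap v b a c) (flipMap a c v b) (continuous_flipMap _ _ _ _)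
    (continuous_flipMap _ _ _ _)
    (fun _ hf => flipMap_mem hvb hac hva hvc hba hbc hR hf)
    (fun _ hf => flipMap_mem hac hvb hva.symm hba.symm hvc.symm hbc.symm hR' hf)
    (fun _ hf => flipMap_flipMap hac hva hvc hba hbc hR' hf)
    (fun _ hf => flipMap_flipMap hvb hva.symm hba.symm hvc.symm hbc.symm hR hf)⟩

/-- Pushing the barycenter `v` of a subdivided triangle `abc` into the triangle. -/
noncomputable def unsubdivideMap (v a b c : V) (f : V → ℝ) : V → ℝ := fun x =>
  if x = v then 0 else if x = a ∨ x = b ∨ x = c then f x + f v / 3 else f x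

/-- The inverse of `unsubdivideMap`. -/
def subdivideMap (v a b c : V) (f : V → ℝ) : V → ℝ := fun x =>
  if x = v then 3 * min (f a) (min (f b) (f c))
  else if x = a ∨ x = b ∨ x = c then f x - min (f a) (min (f b) (f c)) else f x

/-- Removing a vertex of degree three does not change the realization. -/
lemma nonempty_homeomorph_unsubdivide {R : Finset (Finset V)} {v a b c : V} (hva : v ≠ a)
    (hvb : v ≠ b) (hvc : v ≠ c) (hab : a ≠ b) (hac : a ≠ c) (hbc : b ≠ c)
    (hR : ∀ t ∈ R, v ∉ t) (hR' : ∀ t ∈ R, ¬ ({a, b, c} : Finset V) ⊆ t) :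
    Nonempty (triReal (R ∪ {{v, a, b}, {v, b, c}, {v, a, c}}) ≃ₜ triReal (R ∪ {{a, b, c}})) := by
  have min_zero : ∀ (f : V → ℝ) (t : Finset V), (∀ x, 0 ≤ f x) → (∀ x ∉ t, f x = 0) →
      ¬ ({a, b, c} : Finset V) ⊆ t → min (f a) (min (f b) (f c)) = 0 := by
    intro f t h0 hout h
    apply le_antisymm _ (le_min (h0 a) (le_min (h0 b) (h0 c)))
    simp only [Finset.insert_subset_iff, Finset.singleton_subset_iff, not_and_or] at h
    rcases h with h | h | h
    · exact (min_le_left _ _).trans (hout a h).le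
    · exact (min_le_right _ _).trans ((min_le_left _ _).trans (hout b h).le)
    · exact (min_le_right _ _).trans ((min_le_right _ _).trans (hout c h).le)
  refine ⟨homeomorphOfInvOn (unsubdivideMap v a b c) (subdivideMap v a b c) ?_ ?_ ?_ ?_ ?_ ?_⟩
  · refine continuous_pi fun x => ?_
    unfold unsubdivideMap
    split_ifs <;> fun_prop
  · refine continuous_pi fun x => ?_
    unfold subdivideMap
    split_ifs <;> fun_prop
  · rintro f ⟨h0, t, ht, hout, hsum⟩
    refine ⟨fun x => ?_, ?_⟩
    · unfold unsubdivideMap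
      have := h0 x
      have := h0 v
      split_ifs <;> positivity
    rcases Finset.mem_union.1 ht with ht | ht
    · have hv := hout v (hR t ht)
      have : unsubdivideMap v a b c f = f := by
        ext x
        unfold unsubdivideMap
        split_ifs with h1
        · rw [h1, hv]
        · rw [hv]; simp
        · rfl
      rw [this]
      exact ⟨t, Finset.mem_union_left _ ht, hout, hsum⟩
    · have key : (f v + f a + f b + f c = 1) ∧ ∀ x, x ≠ v → x ≠ a → x ≠ b → x ≠ c → f x = 0 := by
        simp only [Finset.mem_insert, Finset.mem_singleton] at ht
        rcases ht with rfl | rfl | rfl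
        · rw [Finset.sum_insert (by simp [hva, hvb]), Finset.sum_insert (by simp [hab]),
            Finset.sum_singleton] at hsum
          have := hout c (by simp [hvc.symm, hac.symm, hbc.symm])
          exact ⟨by linarith, fun x h1 h2 h3 h4 => hout x (by simp [h1, h2, h3])⟩
        · rw [Finset.sum_insert (by simp [hvb, hvc]), Finset.sum_insert (by simp [hbc]),
            Finset.sum_singleton] at hsum
          have := hout a (by simp [hva.symm, hab, hac])
          exact ⟨by linarith, fun x h1 h2 h3 h4 => hout x (by simp [h1, h3, h4])⟩
        · rw [Finset.sum_insert (by simp [hva, hvc]), Finset.sum_insert (by simp [hac]),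
            Finset.sum_singleton] at hsum
          have := hout b (by simp [hvb.symm, hab.symm, hbc])
          exact ⟨by linarith, fun x h1 h2 h3 h4 => hout x (by simp [h1, h2, h4])⟩
      obtain ⟨hs, hz⟩ := key
      refine ⟨{a, b, c}, by simp, fun x hx => ?_, ?_⟩
      · simp only [Finset.mem_insert, Finset.mem_singleton, not_or] at hx
        by_cases hxv : x = v
        · simp [unsubdivideMap, hxv]
        · simp [unsubdivideMap, hx, hxv, hz x hxv hx.1 hx.2.1 hx.2.2]
      · rw [Finset.sum_insert (by simp [hab, hac]), Finset.sum_insert (by simp [hbc]),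
          Finset.sum_singleton]
        simp [unsubdivideMap, hva.symm, hvb.symm, hvc.symm]
        linarith
  · rintro f ⟨h0, t, ht, hout, hsum⟩
    have hm0 : 0 ≤ min (f a) (min (f b) (f c)) := le_min (h0 a) (le_min (h0 b) (h0 c))
    have hma : min (f a) (min (f b) (f c)) ≤ f a := min_le_left _ _
    have hmb : min (f a) (min (f b) (f c)) ≤ f b := (min_le_right _ _).trans (min_le_left _ _)
    have hmc : min (f a) (min (f b) (f c)) ≤ f c := (min_le_right _ _).trans (min_le_right _ _)
    refine ⟨fun x => ?_, ?_⟩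
    · unfold subdivideMap
      split_ifs with h1 h2
      · positivity
      · rcases h2 with rfl | rfl | rfl <;> linarith
      · exact h0 x
    rcases Finset.mem_union.1 ht with ht | ht
    · have hm := min_zero f t h0 hout (hR' t ht)
      have : subdivideMap v a b c f = f := by
        ext x
        unfold subdivideMap
        rw [hm]
        split_ifs with h1
        · rw [h1, hout v (hR t ht), mul_zero]
        · simp
        · rfl
      rw [this]
      exact ⟨t, Finset.mem_union_left _ ht, hout, hsum⟩
    · rw [Finset.mem_singleton] at ht
      subst ht
      rw [Finset.sum_insert (by simp [hab, hac]), Finset.sum_insert (by simp [hbc]),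
        Finset.sum_singleton] at hsum
      have hz : ∀ x, x ≠ v → x ≠ a → x ≠ b → x ≠ c → subdivideMap v a b c f x = 0 := by
        intro x h1 h2 h3 h4
        simp [subdivideMap, h1, h2, h3, h4, hout x]
      have sv : subdivideMap v a b c f v = 3 * min (f a) (min (f b) (f c)) := by
        simp [subdivideMap]
      have sa : subdivideMap v a b c f a = f a - min (f a) (min (f b) (f c)) := by
        simp [subdivideMap, hva.symm]
      have sb : subdivideMap v a b c f b = f b - min (f a) (min (f b) (f c)) := by
        simp [subdivideMap, hvb.symm]
      have sc : subdivideMap v a b c f c = f c - min (f a) (min (f b) (f c)) := by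
        simp [subdivideMap, hvc.symm]
      -- The vertex attaining the minimum loses all its weight, so the image lies in the triangle
      -- spanned by `v` and the other two vertices.
      have hcase : min (f a) (min (f b) (f c)) = f a ∨ min (f a) (min (f b) (f c)) = f b ∨
          min (f a) (min (f b) (f c)) = f c := by
        rcases min_choice (f a) (min (f b) (f c)) with h | h
        · exact Or.inl h
        · rcases min_choice (f b) (f c) with h' | h'
          · exact Or.inr (Or.inl (h.trans h'))
          · exact Or.inr (Or.inr (h.trans h'))
      rcases hcase with h | h | h
      · refine ⟨{v, b, c}, by simp, fun x hx => ?_, ?_⟩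
        · simp only [Finset.mem_insert, Finset.mem_singleton, not_or] at hx
          by_cases hxa : x = a
          · rw [hxa, sa, h, sub_self]
          · exact hz x hx.1 hxa hx.2.1 hx.2.2
        · rw [Finset.sum_insert (by simp [hvb, hvc]), Finset.sum_insert (by simp [hbc]),
            Finset.sum_singleton, sv, sb, sc]
          linarith
      · refine ⟨{v, a, c}, by simp, fun x hx => ?_, ?_⟩
        · simp only [Finset.mem_insert, Finset.mem_singleton, not_or] at hx
          by_cases hxa : x = b
          · rw [hxa, sb, h, sub_self]
          · exact hz x hx.1 hx.2.1 hxa hx.2.2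
        · rw [Finset.sum_insert (by simp [hva, hvc]), Finset.sum_insert (by simp [hac]),
            Finset.sum_singleton, sv, sa, sc]
          linarith
      · refine ⟨{v, a, b}, by simp, fun x hx => ?_, ?_⟩
        · simp only [Finset.mem_insert, Finset.mem_singleton, not_or] at hx
          by_cases hxa : x = c
          · rw [hxa, sc, h, sub_self]
          · exact hz x hx.1 hx.2.1 hx.2.2 hxa
        · rw [Finset.sum_insert (by simp [hva, hvb]), Finset.sum_insert (by simp [hab]),
            Finset.sum_singleton, sv, sa, sb]
          linarith
  · rintro f ⟨h0, t, ht, hout, -⟩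
    have hm : min (f a) (min (f b) (f c)) = 0 := by
      apply min_zero f t h0 hout
      rcases Finset.mem_union.1 ht with ht | ht
      · exact hR' t ht
      · simp only [Finset.mem_insert, Finset.mem_singleton] at ht
        rcases ht with rfl | rfl | rfl <;>
          simp [Finset.insert_subset_iff, hva.symm, hvb.symm, hvc.symm, hab, hac, hbc, hab.symm,
            hac.symm, hbc.symm]
    have sa : unsubdivideMap v a b c f a = f a + f v / 3 := by simp [unsubdivideMap, hva.symm]
    have sb : unsubdivideMap v a b c f b = f b + f v / 3 := by simp [unsubdivideMap, hvb.symm]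
    have sc : unsubdivideMap v a b c f c = f c + f v / 3 := by simp [unsubdivideMap, hvc.symm]
    ext x
    rw [subdivideMap, sa, sb, sc, min_add_add_right, min_add_add_right, hm]
    unfold unsubdivideMap
    split_ifs with h1
    · rw [h1]; ring
    · ring
    · rfl
  · rintro f ⟨h0, t, ht, hout, -⟩
    have hv : f v = 0 := by
      apply hout
      rcases Finset.mem_union.1 ht with ht | ht
      · exact hR t ht
      · rw [Finset.mem_singleton.1 ht]
        simp [hva, hvb, hvc]
    ext x
    by_cases h1 : x = v
    · simp [unsubdivideMap, h1, hv]
    · by_cases h2 : x = a ∨ x = b ∨ x = c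
      · simp [unsubdivideMap, subdivideMap, h1, h2]
      · simp [unsubdivideMap, subdivideMap, h1, h2]

/-- The boundary of a tetrahedron is a sphere. -/
lemma nonempty_homeomorph_tetrahedron {v a b c : V} (hva : v ≠ a) (hvb : v ≠ b) (hvc : v ≠ c)
    (hab : a ≠ b) (hac : a ≠ c) (hbc : b ≠ c) {T : Finset (Finset V)}
    (hT : T = {{v, a, b}, {v, b, c}, {v, a, c}, {a, b, c}}) :
    Nonempty (triReal T ≃ₜ Metric.sphere (0 : EuclideanSpace ℝ (Fin 3)) 1) := by
  -- The boundary of the simplex consists of the points with some barycentric coordinate zero.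
  have hmem : ∀ f : V → ℝ, f ∈ triReal T ↔ (∀ x, 0 ≤ f x) ∧
      (∀ x, x ≠ v → x ≠ a → x ≠ b → x ≠ c → f x = 0) ∧ f v + f a + f b + f c = 1 ∧
      (f v = 0 ∨ f a = 0 ∨ f b = 0 ∨ f c = 0) := by
    intro f
    have s1 : ∑ x ∈ ({v, a, b} : Finset V), f x = f v + f a + f b := by
      rw [Finset.sum_insert (by simp [hva, hvb]), Finset.sum_insert (by simp [hab]),
        Finset.sum_singleton, add_assoc]
    have s2 : ∑ x ∈ ({v, b, c} : Finset V), f x = f v + f b + f c := by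
      rw [Finset.sum_insert (by simp [hvb, hvc]), Finset.sum_insert (by simp [hbc]),
        Finset.sum_singleton, add_assoc]
    have s3 : ∑ x ∈ ({v, a, c} : Finset V), f x = f v + f a + f c := by
      rw [Finset.sum_insert (by simp [hva, hvc]), Finset.sum_insert (by simp [hac]),
        Finset.sum_singleton, add_assoc]
    have s4 : ∑ x ∈ ({a, b, c} : Finset V), f x = f a + f b + f c := by
      rw [Finset.sum_insert (by simp [hab, hac]), Finset.sum_insert (by simp [hbc]),
        Finset.sum_singleton, add_assoc]
    subst hT
    constructor
    · rintro ⟨h0, t, ht, hout, hsum⟩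
      refine ⟨h0, ?_⟩
      simp only [Finset.mem_insert, Finset.mem_singleton] at ht
      rcases ht with rfl | rfl | rfl | rfl
      · have := hout c (by simp [hvc.symm, hac.symm, hbc.symm])
        exact ⟨fun x h1 h2 h3 h4 => hout x (by simp [h1, h2, h3]), by linarith, by simp [this]⟩
      · have := hout a (by simp [hva.symm, hab, hac])
        exact ⟨fun x h1 h2 h3 h4 => hout x (by simp [h1, h3, h4]), by linarith, by simp [this]⟩
      · have := hout b (by simp [hvb.symm, hab.symm, hbc])
        exact ⟨fun x h1 h2 h3 h4 => hout x (by simp [h1, h2, h4]), by linarith, by simp [this]⟩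
      · have := hout v (by simp [hva, hvb, hvc])
        exact ⟨fun x h1 h2 h3 h4 => hout x (by simp [h2, h3, h4]), by linarith, by simp [this]⟩
    · rintro ⟨h0, hz, hsum, h⟩
      refine ⟨h0, ?_⟩
      rcases h with h | h | h | h
      · refine ⟨{a, b, c}, by simp, fun x hx => ?_, by linarith⟩
        simp only [Finset.mem_insert, Finset.mem_singleton, not_or] at hx
        by_cases hxv : x = v
        · rw [hxv, h]
        · exact hz x hxv hx.1 hx.2.1 hx.2.2
      · refine ⟨{v, b, c}, by simp, fun x hx => ?_, by linarith⟩
        simp only [Finset.mem_insert, Finset.mem_singleton, not_or] at hx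
        by_cases hxv : x = a
        · rw [hxv, h]
        · exact hz x hx.1 hxv hx.2.1 hx.2.2
      · refine ⟨{v, a, c}, by simp, fun x hx => ?_, by linarith⟩
        simp only [Finset.mem_insert, Finset.mem_singleton, not_or] at hx
        by_cases hxv : x = b
        · rw [hxv, h]
        · exact hz x hx.1 hx.2.1 hxv hx.2.2
      · refine ⟨{v, a, b}, by simp, fun x hx => ?_, by linarith⟩
        simp only [Finset.mem_insert, Finset.mem_singleton, not_or] at hx
        by_cases hxv : x = c
        · rw [hxv, h]
        · exact hz x hx.1 hx.2.1 hx.2.2 hxv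
  -- `p` forgets a common shift of the four coordinates, normalizing the last to 0. Conversely `G`
  -- subtracts the minimum `m` of the coordinates `y 0, y 1, y 2, 0`, so that one of them vanishes,
  -- and divides by their sum `S`.
  let p : (V → ℝ) → EuclideanSpace ℝ (Fin 3) := fun f => !₂[f v - f c, f a - f c, f b - f c]
  let m : EuclideanSpace ℝ (Fin 3) → ℝ := fun y => min (y 0) (min (y 1) (min (y 2) 0))
  let S : EuclideanSpace ℝ (Fin 3) → ℝ := fun y => y 0 + y 1 + y 2 - 4 * m y
  let G : EuclideanSpace ℝ (Fin 3) → V → ℝ := fun y x =>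
    if x = v then (y 0 - m y) / S y else if x = a then (y 1 - m y) / S y
    else if x = b then (y 2 - m y) / S y else if x = c then (0 - m y) / S y else 0
  have hp : Continuous p := by
    refine (PiLp.continuous_toLp 2 _).comp (continuous_pi fun i => ?_)
    fin_cases i <;> simp <;> fun_prop
  have hm : Continuous m := by fun_prop
  have hS : Continuous S := by fun_prop
  have m0 : ∀ y, m y ≤ y 0 := fun y => min_le_left _ _
  have m1 : ∀ y, m y ≤ y 1 := fun y => (min_le_right _ _).trans (min_le_left _ _)
  have m2 : ∀ y, m y ≤ y 2 := fun y =>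
    (min_le_right _ _).trans ((min_le_right _ _).trans (min_le_left _ _))
  have m3 : ∀ y, m y ≤ 0 := fun y =>
    (min_le_right _ _).trans ((min_le_right _ _).trans (min_le_right _ _))
  have hm_mem : ∀ y, m y = y 0 ∨ m y = y 1 ∨ m y = y 2 ∨ m y = 0 := by
    intro y
    rcases min_choice (y 0) (min (y 1) (min (y 2) 0)) with h | h
    · exact Or.inl h
    · rcases min_choice (y 1) (min (y 2) 0) with h' | h'
      · exact Or.inr (Or.inl (h.trans h'))
      · rcases min_choice (y 2) 0 with h'' | h''
        · exact Or.inr (Or.inr (Or.inl (h.trans (h'.trans h''))))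
        · exact Or.inr (Or.inr (Or.inr (h.trans (h'.trans h''))))
  -- `S` is a sum of nonnegative terms; if it vanished, all four coordinates would equal the last
  -- one, which is 0.
  have S_pos : ∀ y, y ≠ 0 → 0 < S y := by
    intro y hy
    have h0 := m0 y
    have h1 := m1 y
    have h2 := m2 y
    have h3 := m3 y
    by_contra hcon
    have hS' : S y = y 0 + y 1 + y 2 - 4 * m y := rfl
    apply hy
    ext i
    fin_cases i <;> simp <;> linarith
  have p_ne : ∀ f ∈ triReal T, p f ≠ 0 := by
    intro f hf h
    obtain ⟨h0, -, hsum, h4⟩ := (hmem f).1 hf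
    have e0 : f v - f c = 0 := by simpa [p] using congrArg (fun y => y 0) h
    have e1 : f a - f c = 0 := by simpa [p] using congrArg (fun y => y 1) h
    have e2 : f b - f c = 0 := by simpa [p] using congrArg (fun y => y 2) h
    rcases h4 with h4 | h4 | h4 | h4 <;> linarith
  have Gv : ∀ y, G y v = (y 0 - m y) / S y := fun y => by simp [G]
  have Ga : ∀ y, G y a = (y 1 - m y) / S y := fun y => by simp [G, hva.symm]
  have Gb : ∀ y, G y b = (y 2 - m y) / S y := fun y => by simp [G, hvb.symm, hab.symm]
  have Gc : ∀ y, G y c = (0 - m y) / S y := fun y => by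
    simp [G, hvc.symm, hac.symm, hbc.symm]
  have Gx : ∀ y x, x ≠ v → x ≠ a → x ≠ b → x ≠ c → G y x = 0 := fun y x h1 h2 h3 h4 => by
    simp [G, h1, h2, h3, h4]
  have ne_zero : ∀ y : Metric.sphere (0 : EuclideanSpace ℝ (Fin 3)) 1, y.1 ≠ 0 := fun y =>
    ne_zero_of_mem_unit_sphere y
  have hG : ∀ y, y ≠ 0 → G y ∈ triReal T := by
    intro y hy
    have hSy := S_pos y hy
    rw [hmem]
    refine ⟨fun x => ?_, Gx y, ?_, ?_⟩
    · simp only [G]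
      have h0 := m0 y
      have h1 := m1 y
      have h2 := m2 y
      have h3 := m3 y
      split_ifs
      · exact div_nonneg (by linarith) hSy.le
      · exact div_nonneg (by linarith) hSy.le
      · exact div_nonneg (by linarith) hSy.le
      · exact div_nonneg (by linarith) hSy.le
      · exact le_rfl
    · rw [Gv, Ga, Gb, Gc, ← add_div, ← add_div, ← add_div, div_eq_one_iff_eq hSy.ne']
      simp only [S]
      ring
    · rw [Gv, Ga, Gb, Gc]
      rcases hm_mem y with h | h | h | h
      · left; rw [h, sub_self, zero_div]
      · right; left; rw [h, sub_self, zero_div]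
      · right; right; left; rw [h, sub_self, zero_div]
      · right; right; right; rw [h, sub_self, zero_div]
  have pG : ∀ y, y ≠ 0 → p (G y) = (S y)⁻¹ • y := by
    intro y hy
    have hSy := (S_pos y hy).ne'
    ext i
    fin_cases i
    · simp [p, Gv, Gc]; field_simp; ring
    · simp [p, Ga, Gc]; field_simp; ring
    · simp [p, Gb, Gc]; field_simp; ring
  -- The scalar k is needed because points are normalized to length one on the sphere; `G` does not
  -- see positive scaling.
  have G_smul_p : ∀ f ∈ triReal T, ∀ k : ℝ, 0 < k → G (k • p f) = f := by
    intro f hf k hk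
    obtain ⟨h0, hz, hsum, h4⟩ := (hmem f).1 hf
    have hmin : min (f v) (min (f a) (min (f b) (f c))) = 0 := by
      apply le_antisymm
      · rcases h4 with h4 | h4 | h4 | h4
        · exact (min_le_left _ _).trans h4.le
        · exact (min_le_right _ _).trans ((min_le_left _ _).trans h4.le)
        · exact (min_le_right _ _).trans ((min_le_right _ _).trans ((min_le_left _ _).trans h4.le))
        · exact (min_le_right _ _).trans
            ((min_le_right _ _).trans ((min_le_right _ _).trans h4.le))
      · exact le_min (h0 v) (le_min (h0 a) (le_min (h0 b) (h0 c)))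
    have y0 : (k • p f) 0 = k * (f v - f c) := by simp [p]
    have y1 : (k • p f) 1 = k * (f a - f c) := by simp [p]
    have y2 : (k • p f) 2 = k * (f b - f c) := by simp [p]
    have hmy : m (k • p f) = - (k * f c) := by
      have : m (k • p f) = min (k * (f v - f c)) (min (k * (f a - f c))
          (min (k * (f b - f c)) (k * (f c - f c)))) := by
        simp only [m]
        rw [y0, y1, y2, sub_self, mul_zero]
      rw [this, ← mul_min_of_nonneg _ _ hk.le, ← mul_min_of_nonneg _ _ hk.le,
        ← mul_min_of_nonneg _ _ hk.le, min_sub_sub_right, min_sub_sub_right, min_sub_sub_right,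
        hmin]
      ring
    have hSy : S (k • p f) = k := by
      simp only [S]
      rw [hmy, y0, y1, y2]
      linear_combination k * hsum
    ext x
    by_cases h1 : x = v
    · rw [h1, Gv, hSy, hmy, y0]; field_simp; ring
    by_cases h2 : x = a
    · rw [h2, Ga, hSy, hmy, y1]; field_simp; ring
    by_cases h3 : x = b
    · rw [h3, Gb, hSy, hmy, y2]; field_simp; ring
    by_cases h5 : x = c
    · rw [h5, Gc, hSy, hmy]; field_simp; ring
    rw [Gx _ x h1 h2 h3 h5, hz x h1 h2 h3 h5]
  refine ⟨{
    toFun := fun f => ⟨‖p f‖⁻¹ • p f, by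
      rw [mem_sphere_zero_iff_norm, norm_smul, norm_inv, norm_norm]
      exact inv_mul_cancel₀ (norm_ne_zero_iff.2 (p_ne f f.2))⟩
    invFun := fun y => ⟨G y, hG y (ne_zero y)⟩
    left_inv := fun f => Subtype.ext (G_smul_p f f.2 _
      (inv_pos.2 (norm_pos_iff.2 (p_ne f f.2))))
    right_inv := fun y => by
      ext1
      have hpos := S_pos y (ne_zero y)
      have hy : ‖y.1‖ = 1 := mem_sphere_zero_iff_norm.1 y.2
      change ‖p (G y)‖⁻¹ • p (G y) = y
      rw [pG y (ne_zero y), norm_smul, hy, mul_one, norm_inv, Real.norm_of_nonneg hpos.le, inv_inv,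
        smul_smul, mul_inv_cancel₀ hpos.ne', one_smul]
    continuous_toFun := ?_
    continuous_invFun := ?_ }⟩
  · refine Continuous.subtype_mk ?_ _
    have h1 : Continuous fun f : triReal T => p f := hp.comp continuous_subtype_val
    exact (h1.norm.inv₀ fun f => norm_ne_zero_iff.2 (p_ne f f.2)).smul h1
  · refine Continuous.subtype_mk (continuous_pi fun x => ?_) _
    have h1 : ∀ y : Metric.sphere (0 : EuclideanSpace ℝ (Fin 3)) 1, S y ≠ 0 :=
      fun y => (S_pos y (ne_zero y)).ne'
    simp only [G]
    split_ifs
    · exact Continuous.div (by fun_prop) (by fun_prop) h1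
    · exact Continuous.div (by fun_prop) (by fun_prop) h1
    · exact Continuous.div (by fun_prop) (by fun_prop) h1
    · exact Continuous.div (by fun_prop) (by fun_prop) h1
    · exact continuous_const

end Realization

/-! ### Surfaces of Euler characteristic two are spheres. -/

section Spheres

variable {V : Type*} [DecidableEq V]

lemma Finset.eq_pair_of_subset_four {e : Finset V} {v a b c : V} (he : e.card = 2)
    (h : e ⊆ {v, a, b, c}) : e = {v, a} ∨ e = {v, b} ∨ e = {v, c} ∨ e = {a, b} ∨ e = {a, c} ∨
      e = {b, c} := by
  obtain ⟨x, y, hxy, rfl⟩ := Finset.card_eq_two.1 he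
  have hx : x ∈ ({v, a, b, c} : Finset V) := h (by simp)
  have hy : y ∈ ({v, a, b, c} : Finset V) := h (by simp)
  simp only [Finset.mem_insert, Finset.mem_singleton] at hx hy
  have hc := Finset.pair_comm x y
  rcases hx with rfl | rfl | rfl | rfl <;> rcases hy with rfl | rfl | rfl | rfl <;>
    first
    | exact absurd rfl hxy
    | simp only [true_or, or_true]
    | (rw [hc]; simp only [true_or, or_true])

lemma Finset.two_le_card_filter_subset {M : Finset (Finset V)} (s u : Finset V) {e : Finset V}
    (hs : s ∈ M) (hu : u ∈ M) (hsu : s ≠ u) (hes : e ⊆ s) (heu : e ⊆ u) :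
    2 ≤ (M.filter (e ⊆ ·)).card := by
  rw [← Finset.card_pair hsu]
  apply Finset.card_le_card
  intro w
  simp only [Finset.mem_insert, Finset.mem_singleton, Finset.mem_filter]
  rintro (rfl | rfl)
  · exact ⟨hs, hes⟩
  · exact ⟨hu, heu⟩

namespace IsSurface

variable {T : Finset (Finset V)}

/-- A set of triangles around `σ` without boundary consists of all triangles around `σ`. -/
lemma mem_of_closed (hT : IsSurface T) {σ : Finset V} (hσ : σ.card ≤ 1) {L : Finset (Finset V)}
    (hL : L ⊆ T) {s₀ : Finset V} (hs₀ : s₀ ∈ L) (hσs : σ ⊆ s₀)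
    (hcl : ∀ t ∈ L, ∀ e : Finset V, e.card = 2 → σ ⊆ e → e ⊆ t → 2 ≤ (L.filter (e ⊆ ·)).card) :
    ∀ t ∈ T, σ ⊆ t → t ∈ L := by
  intro t ht hσt
  refine hT.conn σ hσ (· ∈ L) ?_ s₀ (hL hs₀) t ht hσs hσt hs₀
  intro s hs u hu hσs hσu hsu hsL
  have h1 := hcl s hsL (s ∩ u) hsu (Finset.subset_inter hσs hσu) Finset.inter_subset_left
  have h2 := hT.card_filter (s ∩ u) hsu ⟨s, hs, Finset.inter_subset_left⟩
  have h3 : L.filter (s ∩ u ⊆ ·) = T.filter (s ∩ u ⊆ ·) :=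
    Finset.eq_of_subset_of_card_le (Finset.filter_subset_filter _ hL) (by omega)
  have h4 : u ∈ T.filter (s ∩ u ⊆ ·) := Finset.mem_filter.2 ⟨hu, Finset.inter_subset_right⟩
  rw [← h3] at h4
  exact (Finset.mem_filter.1 h4).1

/-- Two chords of a vertex link in a sphere do not cross. -/
lemma not_crossing (hT : IsSurface T) (hχ : T.card + 4 = 2 * (triVerts T).card) {v a b c d : V}
    (hva : v ≠ a) (hvb : v ≠ b) (hvc : v ≠ c) (hvd : v ≠ d) (hab : a ≠ b) (hac : a ≠ c)
    (had : a ≠ d) (hbc : b ≠ c) (hbd : b ≠ d) (hcd : c ≠ d)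
    (hvbc : {v, b, c} ∈ T) (hvcd : {v, c, d} ∈ T) (hea : {v, a} ∈ triEdges T)
    (heac : {a, c} ∈ triEdges T) (hebd : {b, d} ∈ triEdges T) : False := by
  have hevc : {v, c} ∈ triEdges T := mem_triEdges.2 ⟨Finset.card_pair hvc, _, hvbc, by
    intro x; simp; tauto⟩
  let C : Finset (Finset V) := {{v, a}, {v, c}, {a, c}}
  have hne1 : ({v, a} : Finset V) ≠ {v, c} := fun h => by
    have : a ∈ ({v, c} : Finset V) := h ▸ (by simp)
    simp [hva.symm, hac] at this
  have hne2 : ({v, a} : Finset V) ≠ {a, c} := fun h => by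
    have : v ∈ ({a, c} : Finset V) := h ▸ (by simp)
    simp [hva, hvc] at this
  have hne3 : ({v, c} : Finset V) ≠ {a, c} := fun h => by
    have : v ∈ ({a, c} : Finset V) := h ▸ (by simp)
    simp [hva, hvc] at this
  -- The cycle vac bounds, so its bounding chain `y` is a two-colouring of the triangles that
  -- changes exactly across the edges of `C`.
  let z : Finset V → ZMod 2 := fun e => if e ∈ C then 1 else 0
  obtain ⟨y, hy⟩ := hT.exists_bdry ⟨_, hvbc⟩ hχ z (by
    intro x _
    have h1 : ∑ e ∈ (triEdges T).filter (x ∈ ·), z e = ∑ e ∈ C, if x ∈ e then (1 : ZMod 2) else 0 := by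
      have hC : C ⊆ triEdges T := by
        intro e he
        simp only [C, Finset.mem_insert, Finset.mem_singleton] at he
        rcases he with rfl | rfl | rfl <;> assumption
      rw [Finset.sum_filter, ← Finset.sum_subset hC]
      · refine Finset.sum_congr rfl fun e he => ?_
        simp [z, he]
      · intro e _ he
        simp [z, he]
    rw [h1, Finset.sum_insert (by simp [hne1, hne2]), Finset.sum_insert (by simp [hne3]),
      Finset.sum_singleton]
    by_cases h1 : x = v
    · subst h1
      simp [hva, hvc]
      decide
    by_cases h2 : x = a
    · subst h2
      simp [hva.symm, hac]
      decide
    by_cases h3 : x = c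
    · subst h3
      simp [hvc.symm, hac.symm]
      decide
    simp [h1, h2, h3])
  have hpair : ∀ s ∈ T, ∀ t ∈ T, (s ∩ t).card = 2 → y s + y t = z (s ∩ t) := by
    intro s hs t ht hst
    rw [← hy (s ∩ t) (mem_triEdges.2 ⟨hst, s, hs, Finset.inter_subset_left⟩)]
    have hne : s ≠ t := by
      rintro rfl
      rw [Finset.inter_self, hT.card_eq s hs] at hst
      omega
    have : ({s, t} : Finset (Finset V)) = T.filter (s ∩ t ⊆ ·) := by
      apply Finset.eq_of_subset_of_card_le
      · intro u
        simp only [Finset.mem_insert, Finset.mem_singleton, Finset.mem_filter]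
        rintro (rfl | rfl)
        · exact ⟨hs, Finset.inter_subset_left⟩
        · exact ⟨ht, Finset.inter_subset_right⟩
      · rw [hT.card_filter _ hst ⟨s, hs, Finset.inter_subset_left⟩, Finset.card_pair hne]
    rw [← this, Finset.sum_pair hne]
  -- No edge of `C` passes through such an x, so the colour is constant on the star of x.
  have hstar : ∀ x, x ≠ v → x ≠ a → x ≠ c → ∀ s ∈ T, ∀ t ∈ T, x ∈ s → x ∈ t → y s = y t := by
    intro x hxv hxa hxc s hs t ht hxs hxt
    refine (hT.conn {x} (by simp) (fun u => y u = y s) ?_ s hs t ht (by simpa) (by simpa) rfl).symm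
    intro p hp q hq hxp hxq hpq h
    have h1 := hpair p hp q hq hpq
    have h2 : z (p ∩ q) = 0 := by
      have hx : x ∈ p ∩ q := by simpa using And.intro hxp hxq
      have : p ∩ q ∉ C := by
        intro hC
        simp only [C, Finset.mem_insert, Finset.mem_singleton] at hC
        rcases hC with hC | hC | hC <;> rw [hC] at hx <;> simp [hxv, hxa, hxc] at hx
      simp [z, this]
    rw [h2] at h1
    rw [← CharTwo.add_eq_zero.1 h1, h]
  -- A triangle on bd lies in the stars of both b and d, so vbc and vcd have the same colour,
  -- although they are separated by the edge vc of `C`.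
  obtain ⟨_, τ, hτ, hbdτ⟩ := mem_triEdges.1 hebd
  simp only [Finset.insert_subset_iff, Finset.singleton_subset_iff] at hbdτ
  have h1 := hstar b hvb.symm hab.symm hbc τ hτ _ hvbc hbdτ.1 (by simp)
  have h2 := hstar d hvd.symm had.symm hcd.symm τ hτ _ hvcd hbdτ.2 (by simp)
  have hi : ({v, b, c} ∩ {v, c, d} : Finset V) = {v, c} :=
    Finset.inter_eq_of_card (Finset.card_pair hvc) (hT.card_eq _ hvbc) (hT.card_eq _ hvcd)
      (by intro x; simp; tauto) (by intro x; simp; tauto) (fun h => by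
        have : b ∈ ({v, c, d} : Finset V) := h ▸ (by simp)
        simp [hvb.symm, hbc, hbd] at this)
  have h3 := hpair _ hvbc _ hvcd (by rw [hi, Finset.card_pair hvc])
  rw [hi, ← h1, ← h2, CharTwo.add_self_eq_zero] at h3
  simp [z, C] at h3

/-- The data of a flip of the edge `vb` of a surface. -/
lemma exists_flip (hT : IsSurface T) {v b a c : V} (hvb : v ≠ b) (hac : a ≠ c)
    (hva : v ≠ a) (hvc : v ≠ c) (hba : b ≠ a) (hbc : b ≠ c) (h1 : {v, b, a} ∈ T)
    (h2 : {v, b, c} ∈ T) (h3 : {a, c} ∉ triEdges T) :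
    ∃ T' : Finset (Finset V), IsSurface T' ∧ T'.Nonempty ∧ T'.card = T.card ∧
      triVerts T' = triVerts T ∧ (T'.filter (v ∈ ·)).card + 1 = (T.filter (v ∈ ·)).card ∧
      Nonempty (triReal T ≃ₜ triReal T') := by
  have hno : ∀ t ∈ T, ¬ ({a, c} : Finset V) ⊆ t := fun t ht h =>
    h3 (mem_triEdges.2 ⟨Finset.card_pair hac, t, ht, h⟩)
  have hne : ({v, b, a} : Finset V) ≠ {v, b, c} := fun h => by
    have : a ∈ ({v, b, c} : Finset V) := h ▸ (by simp)
    simp [hva.symm, hba.symm, hac] at this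
  have hne' : ({a, c, v} : Finset V) ≠ {a, c, b} := fun h => by
    have : v ∈ ({a, c, b} : Finset V) := h ▸ (by simp)
    simp [hva, hvb, hvc] at this
  let D : Finset (Finset V) := {{v, b, a}, {v, b, c}}
  let D' : Finset (Finset V) := {{a, c, v}, {a, c, b}}
  let R := T \ D
  have hDT : D ⊆ T := by
    intro t; simp only [D, Finset.mem_insert, Finset.mem_singleton]
    rintro (rfl | rfl) <;> assumption
  have hTR : T = R ∪ D := (Finset.sdiff_union_of_subset hDT).symm
  have hRD : Disjoint R D := Finset.sdiff_disjoint
  have hRT : R ⊆ T := Finset.sdiff_subset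
  have hRac : ∀ t ∈ R, ¬ ({a, c} : Finset V) ⊆ t := fun t ht => hno t (hRT ht)
  have hRvb : ∀ t ∈ R, ¬ ({v, b} : Finset V) ⊆ t := by
    intro t ht h
    have hD : D = T.filter (({v, b} : Finset V) ⊆ ·) := by
      apply Finset.eq_of_subset_of_card_le
      · intro u hu
        refine Finset.mem_filter.2 ⟨hDT hu, ?_⟩
        simp only [D, Finset.mem_insert, Finset.mem_singleton] at hu
        rcases hu with rfl | rfl <;> intro x <;> simp <;> tauto
      · rw [hT.card_filter _ (Finset.card_pair hvb) ⟨t, hRT ht, h⟩, Finset.card_pair hne]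
    exact Finset.disjoint_left.1 hRD ht (hD ▸ Finset.mem_filter.2 ⟨hRT ht, h⟩)
  have hRD' : Disjoint R D' := by
    rw [Finset.disjoint_left]
    intro t ht htD
    refine hRac t ht ?_
    simp only [D', Finset.mem_insert, Finset.mem_singleton] at htD
    rcases htD with rfl | rfl <;> intro x <;> simp <;> tauto
  have hDc : ∀ e : Finset V, (D.filter (e ⊆ ·)).card =
      (if e ⊆ {v, b, a} then 1 else 0) + (if e ⊆ {v, b, c} then 1 else 0) := fun e => by
    rw [Finset.card_filter, Finset.sum_pair hne]
  have hDc' : ∀ e : Finset V, (D'.filter (e ⊆ ·)).card =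
      (if e ⊆ {a, c, v} then 1 else 0) + (if e ⊆ {a, c, b} then 1 else 0) := fun e => by
    rw [Finset.card_filter, Finset.sum_pair hne']
  have hedge : ∀ e : Finset V, e.card = 2 →
      (D.filter (e ⊆ ·)).card = (D'.filter (e ⊆ ·)).card ∨
      ((D.filter (e ⊆ ·)).card = 2 ∧ (D'.filter (e ⊆ ·)).card = 0) ∨
      ((∀ t ∈ R ∪ D, ¬ e ⊆ t) ∧ (D'.filter (e ⊆ ·)).card = 2) := by
    -- The old diagonal vb loses both its triangles, the new diagonal ac was not an edge, and the
    -- four sides keep one triangle each.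
    intro e he
    rw [← hTR, hDc, hDc']
    by_cases hsub : e ⊆ {v, b, a, c}
    · rcases Finset.eq_pair_of_subset_four he hsub with rfl | rfl | rfl | rfl | rfl | rfl
      · right; left
        simp [Finset.insert_subset_iff, hva, hvb, hvc, hba, hbc, hvb.symm]
      · left
        simp [Finset.insert_subset_iff, hva, hvb, hvc, hba.symm, hva.symm, hac]
      · left
        simp [Finset.insert_subset_iff, hva, hvb, hvc, hbc.symm, hvc.symm, hac.symm]
      · left
        simp [Finset.insert_subset_iff, hvb.symm, hba, hbc, hba.symm, hva.symm, hac]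
      · left
        simp [Finset.insert_subset_iff, hvb.symm, hba, hbc, hbc.symm, hvc.symm, hac.symm]
      · right; right
        exact ⟨hno, by simp [Finset.insert_subset_iff]⟩
    · left
      rw [if_neg, if_neg, if_neg, if_neg] <;> refine fun h => hsub (h.trans ?_) <;> intro x <;>
        simp <;> tauto
  have hsurf : IsSurface (R ∪ D') := by
    refine IsSurface.replace (R := R) (D := D) (D' := D') (hTR ▸ hT) hRD hRD' ?_ hedge ?_ ?_
      ⟨_, Finset.mem_insert_self _ _⟩
    · intro t ht
      simp only [D', Finset.mem_insert, Finset.mem_singleton] at ht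
      rcases ht with rfl | rfl
      · exact Finset.card_three_of_ne hac hva.symm hvc.symm
      · exact Finset.card_three_of_ne hac hba.symm hbc.symm
    · have h4 : ({a, c, v} ∩ {a, c, b} : Finset V).card = 2 := by
        rw [Finset.inter_eq_of_card (Finset.card_pair hac)
          (Finset.card_three_of_ne hac hva.symm hvc.symm)
          (Finset.card_three_of_ne hac hba.symm hbc.symm) (by intro x; simp; tauto)
          (by intro x; simp; tauto) hne', Finset.card_pair hac]
      intro s hs t ht hst
      simp only [D', Finset.mem_insert, Finset.mem_singleton] at hs ht
      rcases hs with rfl | rfl <;> rcases ht with rfl | rfl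
      · exact absurd rfl hst
      · exact h4
      · rw [Finset.inter_comm]; exact h4
      · exact absurd rfl hst
    · intro t ht x hx
      have : x = v ∨ x = b ∨ x = a ∨ x = c := by
        simp only [D', Finset.mem_insert, Finset.mem_singleton] at ht
        rcases ht with rfl | rfl <;> simp at hx <;> tauto
      rcases this with rfl | rfl | rfl | rfl
      · exact ⟨_, Finset.mem_insert_self _ _, by simp⟩
      · exact ⟨_, Finset.mem_insert_self _ _, by simp⟩
      · exact ⟨_, Finset.mem_insert_self _ _, by simp⟩
      · exact ⟨_, Finset.mem_insert_of_mem (Finset.mem_singleton_self _), by simp⟩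
  refine ⟨R ∪ D', hsurf, ⟨{a, c, v}, by simp [D']⟩, ?_, ?_, ?_, ?_⟩
  · conv_rhs => rw [hTR]
    rw [Finset.card_union_of_disjoint hRD, Finset.card_union_of_disjoint hRD',
      Finset.card_pair hne, Finset.card_pair hne']
  · conv_rhs => rw [hTR]
    rw [triVerts, triVerts, Finset.union_biUnion, Finset.union_biUnion]
    congr 1
    ext x
    simp [D, D']
    tauto
  · conv_rhs => rw [hTR]
    rw [Finset.filter_union, Finset.filter_union,
      Finset.card_union_of_disjoint (Finset.disjoint_filter_filter hRD),
      Finset.card_union_of_disjoint (Finset.disjoint_filter_filter hRD'), add_assoc]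
    congr 1
    rw [Finset.card_filter, Finset.card_filter, Finset.sum_pair hne', Finset.sum_pair hne]
    simp [hva, hvb, hvc]
  · have := nonempty_homeomorph_flip hvb hac hva hvc hba hbc hRvb hRac
    rw [hTR]
    exact this

/-- The data of the removal of a vertex of degree three of a surface. -/
lemma exists_unsubdivide (hT : IsSurface T) {v a b c : V} (hva : v ≠ a) (hvb : v ≠ b) (hvc : v ≠ c)
    (hab : a ≠ b) (hac : a ≠ c) (hbc : b ≠ c) (h1 : {v, a, b} ∈ T) (h2 : {v, b, c} ∈ T)
    (h3 : {v, a, c} ∈ T) (h4 : {a, b, c} ∉ T)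
    (hstar : ∀ t ∈ T, v ∈ t → t = {v, a, b} ∨ t = {v, b, c} ∨ t = {v, a, c}) :
    ∃ T' : Finset (Finset V), IsSurface T' ∧ T'.Nonempty ∧ T'.card + 2 = T.card ∧
      (triVerts T').card + 1 = (triVerts T).card ∧ Nonempty (triReal T ≃ₜ triReal T') := by
  let D : Finset (Finset V) := {{v, a, b}, {v, b, c}, {v, a, c}}
  let D' : Finset (Finset V) := {{a, b, c}}
  let R := T \ D
  have hne1 : ({v, a, b} : Finset V) ≠ {v, b, c} := fun h => by
    have : a ∈ ({v, b, c} : Finset V) := h ▸ (by simp)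
    simp [hva.symm, hab, hac] at this
  have hne2 : ({v, a, b} : Finset V) ≠ {v, a, c} := fun h => by
    have : b ∈ ({v, a, c} : Finset V) := h ▸ (by simp)
    simp [hvb.symm, hab.symm, hbc] at this
  have hne3 : ({v, b, c} : Finset V) ≠ {v, a, c} := fun h => by
    have : b ∈ ({v, a, c} : Finset V) := h ▸ (by simp)
    simp [hvb.symm, hab.symm, hbc] at this
  have hDT : D ⊆ T := by
    intro t; simp only [D, Finset.mem_insert, Finset.mem_singleton]
    rintro (rfl | rfl | rfl) <;> assumption
  have hTR : T = R ∪ D := (Finset.sdiff_union_of_subset hDT).symm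
  have hRD : Disjoint R D := Finset.sdiff_disjoint
  have hRT : R ⊆ T := Finset.sdiff_subset
  have hRv : ∀ t ∈ R, v ∉ t := by
    intro t ht hv
    refine Finset.disjoint_left.1 hRD ht ?_
    simpa [D] using hstar t (hRT ht) hv
  have hRabc : ∀ t ∈ R, ¬ ({a, b, c} : Finset V) ⊆ t := by
    intro t ht h
    have := Finset.eq_of_subset_of_card_le h
      (by rw [hT.card_eq t (hRT ht), Finset.card_three_of_ne hab hac hbc])
    exact h4 (this ▸ hRT ht)
  have hRD' : Disjoint R D' := by
    rw [Finset.disjoint_singleton_right]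
    exact fun h => h4 (hRT h)
  have hDc : ∀ P : Finset V → Prop, ∀ [DecidablePred P], (D.filter P).card =
      (if P {v, a, b} then 1 else 0) + ((if P {v, b, c} then 1 else 0) +
        (if P {v, a, c} then 1 else 0)) := by
    intro P _
    rw [Finset.card_filter, Finset.sum_insert (by simp [hne1, hne2]), Finset.sum_pair hne3]
  have hDcard : D.card = 3 := Finset.card_three_of_ne hne1 hne2 hne3
  have hedge : ∀ e : Finset V, e.card = 2 →
      (D.filter (e ⊆ ·)).card = (D'.filter (e ⊆ ·)).card ∨
      ((D.filter (e ⊆ ·)).card = 2 ∧ (D'.filter (e ⊆ ·)).card = 0) ∨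
      ((∀ t ∈ R ∪ D, ¬ e ⊆ t) ∧ (D'.filter (e ⊆ ·)).card = 2) := by
    -- The three edges at v disappear, and the sides of abc keep one triangle each.
    intro e he
    rw [hDc, Finset.card_filter, Finset.sum_singleton]
    by_cases hsub : e ⊆ {v, a, b, c}
    · rcases Finset.eq_pair_of_subset_four he hsub with rfl | rfl | rfl | rfl | rfl | rfl
      · right; left
        simp [Finset.insert_subset_iff, hva, hvb, hvc, hva.symm, hab, hac]
      · right; left
        simp [Finset.insert_subset_iff, hva, hvb, hvc, hvb.symm, hab.symm, hbc]
      · right; left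
        simp [Finset.insert_subset_iff, hva, hvb, hvc, hvc.symm, hac.symm, hbc.symm]
      · left
        simp [Finset.insert_subset_iff, hva.symm, hvb.symm, hab, hac, hab.symm, hbc]
      · left
        simp [Finset.insert_subset_iff, hva.symm, hvc.symm, hab, hac, hac.symm, hbc.symm]
      · left
        simp [Finset.insert_subset_iff, hvb.symm, hvc.symm, hab.symm, hbc, hac.symm, hbc.symm]
    · left
      rw [if_neg, if_neg, if_neg, if_neg] <;> refine fun h => hsub (h.trans ?_) <;> intro x <;>
        simp <;> tauto
  have hsurf : IsSurface (R ∪ D') := by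
    refine IsSurface.replace (R := R) (D := D) (D' := D') (hTR ▸ hT) hRD hRD' ?_ hedge ?_ ?_
      ⟨_, Finset.mem_insert_self _ _⟩
    · intro t ht
      rw [Finset.mem_singleton.1 ht]
      exact Finset.card_three_of_ne hab hac hbc
    · intro s hs t ht hst
      exact absurd ((Finset.mem_singleton.1 hs).trans (Finset.mem_singleton.1 ht).symm) hst
    · intro t ht x hx
      rw [Finset.mem_singleton.1 ht] at hx
      simp only [Finset.mem_insert, Finset.mem_singleton] at hx
      rcases hx with rfl | rfl | rfl
      · exact ⟨_, Finset.mem_insert_self _ _, by simp⟩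
      · exact ⟨_, Finset.mem_insert_self _ _, by simp⟩
      · exact ⟨_, Finset.mem_insert_of_mem (Finset.mem_insert_self _ _), by simp⟩
  refine ⟨R ∪ D', hsurf, ⟨{a, b, c}, by simp [D']⟩, ?_, ?_, ?_⟩
  · conv_rhs => rw [hTR]
    rw [Finset.card_union_of_disjoint hRD, Finset.card_union_of_disjoint hRD', hDcard]
    rfl
  · have hv : v ∉ triVerts (R ∪ D') := by
      rw [mem_triVerts]
      rintro ⟨t, ht, hvt⟩
      rcases Finset.mem_union.1 ht with ht | ht
      · exact hRv t ht hvt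
      · rw [Finset.mem_singleton.1 ht] at hvt
        simp [hva, hvb, hvc] at hvt
    rw [← Finset.card_insert_of_notMem hv]
    congr 1
    conv_rhs => rw [hTR]
    rw [triVerts, triVerts, Finset.union_biUnion, Finset.union_biUnion, ← Finset.union_insert]
    congr 1
    ext x
    simp [D, D']
  · have := nonempty_homeomorph_unsubdivide hva hvb hvc hab hac hbc hRv hRabc
    rw [hTR]
    exact this

/-- The four triangles already cover each of their edges twice, so by connectedness there are no
others. -/
lemma eq_tetrahedron (hT : IsSurface T) {v a b c : V} (hva : v ≠ a) (hvb : v ≠ b) (hvc : v ≠ c)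
    (h1 : {v, a, b} ∈ T) (h2 : {v, b, c} ∈ T) (h3 : {v, a, c} ∈ T) (h4 : {a, b, c} ∈ T)
    (hne1 : ({v, a, b} : Finset V) ≠ {v, b, c}) (hne2 : ({v, a, b} : Finset V) ≠ {v, a, c})
    (hne3 : ({v, b, c} : Finset V) ≠ {v, a, c}) :
    T = {{v, a, b}, {v, b, c}, {v, a, c}, {a, b, c}} := by
  have hMT : ({{v, a, b}, {v, b, c}, {v, a, c}, {a, b, c}} : Finset (Finset V)) ⊆ T := by
    intro t; simp only [Finset.mem_insert, Finset.mem_singleton]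
    rintro (rfl | rfl | rfl | rfl) <;> assumption
  have hneL : ∀ s : Finset V, v ∈ s → s ≠ {a, b, c} := fun s hs h => by
    rw [h] at hs
    simp [hva, hvb, hvc] at hs
  refine Finset.Subset.antisymm (fun t ht => ?_) hMT
  refine hT.mem_of_closed (σ := ∅) (by simp) hMT (Finset.mem_insert_self _ _) (by simp)
    (fun t htM e he _ het => ?_) t ht (by simp)
  have hsub : e ⊆ {v, a, b, c} := het.trans (by
    simp only [Finset.mem_insert, Finset.mem_singleton] at htM
    rcases htM with rfl | rfl | rfl | rfl <;> intro x <;> simp <;> tauto)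
  rcases Finset.eq_pair_of_subset_four he hsub with rfl | rfl | rfl | rfl | rfl | rfl
  · exact Finset.two_le_card_filter_subset {v, a, b} {v, a, c} (by simp) (by simp) hne2
      (by simp [Finset.insert_subset_iff]) (by simp [Finset.insert_subset_iff])
  · exact Finset.two_le_card_filter_subset {v, a, b} {v, b, c} (by simp) (by simp) hne1
      (by simp [Finset.insert_subset_iff]) (by simp [Finset.insert_subset_iff])
  · exact Finset.two_le_card_filter_subset {v, b, c} {v, a, c} (by simp) (by simp) hne3
      (by simp [Finset.insert_subset_iff]) (by simp [Finset.insert_subset_iff])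
  · exact Finset.two_le_card_filter_subset {v, a, b} {a, b, c} (by simp) (by simp)
      (hneL _ (by simp)) (by simp) (by simp [Finset.insert_subset_iff])
  · exact Finset.two_le_card_filter_subset {v, a, c} {a, b, c} (by simp) (by simp)
      (hneL _ (by simp)) (by simp) (by simp [Finset.insert_subset_iff])
  · exact Finset.two_le_card_filter_subset {v, b, c} {a, b, c} (by simp) (by simp)
      (hneL _ (by simp)) (by simp) (by simp)

/-- A surface of Euler characteristic two is a sphere. -/
theorem nonempty_homeomorph_sphere (n : ℕ) : ∀ T : Finset (Finset V), IsSurface T → T.Nonempty →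
    T.card + 4 = 2 * (triVerts T).card → (triVerts T).card = n →
    Nonempty (triReal T ≃ₜ Metric.sphere (0 : EuclideanSpace ℝ (Fin 3)) 1) := by
  induction n using Nat.strong_induction_on with
  | _ n ih =>
  -- The inner induction is on the degree k of a fixed vertex `v`: flips lower k and keep n, and
  -- removing `v` lowers n.
  suffices key : ∀ k : ℕ, ∀ v : V, ∀ T : Finset (Finset V), IsSurface T → v ∈ triVerts T →
      T.card + 4 = 2 * (triVerts T).card → (triVerts T).card = n →
      (T.filter (v ∈ ·)).card = k →
      Nonempty (triReal T ≃ₜ Metric.sphere (0 : EuclideanSpace ℝ (Fin 3)) 1) by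
    intro T hT ⟨t, ht⟩ hχ hn
    obtain ⟨v, hv⟩ := Finset.card_pos.1 (by rw [hT.card_eq t ht]; omega : 0 < t.card)
    exact key _ v T hT (mem_triVerts.2 ⟨t, ht, hv⟩) hχ hn rfl
  intro k v
  induction k using Nat.strong_induction_on with
  | _ k ihk =>
  intro T hT hv hχ hn hk
  have hflip : ∀ {b a c : V}, v ≠ b → a ≠ c → v ≠ a → v ≠ c → b ≠ a → b ≠ c → {v, b, a} ∈ T →
      {v, b, c} ∈ T → {a, c} ∉ triEdges T →
      Nonempty (triReal T ≃ₜ Metric.sphere (0 : EuclideanSpace ℝ (Fin 3)) 1) := by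
    intro b a c hvb hac hva hvc hba hbc h1 h2 h3
    obtain ⟨T', hT', _, hcard, hverts, hdeg, ⟨φ⟩⟩ :=
      hT.exists_flip hvb hac hva hvc hba hbc h1 h2 h3
    obtain ⟨ψ⟩ := ihk _ (by omega : (T'.filter (v ∈ ·)).card < k) T' hT' (hverts ▸ hv)
      (by rw [hcard, hverts, hχ]) (by rw [hverts, hn]) rfl
    exact ⟨φ.trans ψ⟩
  obtain ⟨t, ht, hvt⟩ := mem_triVerts.1 hv
  obtain ⟨b, hb, hbv⟩ := Finset.exists_mem_ne (by rw [hT.card_eq t ht]; omega) v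
  obtain ⟨c, hcv, hcb, rfl⟩ := Finset.exists_eq_insert_of_pair_subset (hT.card_eq t ht) hbv.symm
    (by simp [Finset.insert_subset_iff, hb, hvt])
  -- Here and below, a, b, c, d become consecutive vertices of the link of `v`, with a = d exactly
  -- when that link is a cycle of length three.
  obtain ⟨a, hav, hab, hac, hvba, hallb⟩ := hT.exists_other_vertex hbv.symm hcv.symm hcb.symm ht
  have ht' : {v, c, b} ∈ T := by rwa [Finset.pair_comm c b]
  obtain ⟨d, hdv, hdc, hdb, hvcd, hallc⟩ := hT.exists_other_vertex hcv.symm hbv.symm hcb ht'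
  by_cases had : a = d
  · subst had
    have hvab : {v, a, b} ∈ T := by rwa [Finset.pair_comm a b]
    have hvac : {v, a, c} ∈ T := by rwa [Finset.pair_comm a c]
    let L : Finset (Finset V) := {{v, a, b}, {v, b, c}, {v, a, c}}
    have hne1 : ({v, a, b} : Finset V) ≠ {v, b, c} := fun h => by
      have : a ∈ ({v, b, c} : Finset V) := h ▸ (by simp)
      simp [hav, hab, hac] at this
    have hne2 : ({v, a, b} : Finset V) ≠ {v, a, c} := fun h => by
      have : b ∈ ({v, a, c} : Finset V) := h ▸ (by simp)
      simp [hbv, hab.symm, hcb.symm] at this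
    have hne3 : ({v, b, c} : Finset V) ≠ {v, a, c} := fun h => by
      have : b ∈ ({v, a, c} : Finset V) := h ▸ (by simp)
      simp [hbv, hab.symm, hcb.symm] at this
    have hLT : L ⊆ T := by
      intro t; simp only [L, Finset.mem_insert, Finset.mem_singleton]
      rintro (rfl | rfl | rfl) <;> assumption
    have hstar : ∀ t ∈ T, v ∈ t → t = {v, a, b} ∨ t = {v, b, c} ∨ t = {v, a, c} := by
      intro t ht hvt
      have := hT.mem_of_closed (σ := {v}) (by simp) hLT (s₀ := {v, a, b}) (by simp [L]) (by simp)
        (fun t htL e he hve het => ?_) t ht (by simpa)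
      · simpa [L] using this
      have hsub : e ⊆ {v, a, b, c} := het.trans (by
        simp only [L, Finset.mem_insert, Finset.mem_singleton] at htL
        rcases htL with rfl | rfl | rfl <;> intro x <;> simp <;> tauto)
      rw [Finset.singleton_subset_iff] at hve
      rcases Finset.eq_pair_of_subset_four he hsub with rfl | rfl | rfl | rfl | rfl | rfl
      · exact Finset.two_le_card_filter_subset {v, a, b} {v, a, c} (by simp [L]) (by simp [L]) hne2
          (by simp [Finset.insert_subset_iff]) (by simp [Finset.insert_subset_iff])
      · exact Finset.two_le_card_filter_subset {v, a, b} {v, b, c} (by simp [L]) (by simp [L]) hne1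
          (by simp [Finset.insert_subset_iff]) (by simp [Finset.insert_subset_iff])
      · exact Finset.two_le_card_filter_subset {v, b, c} {v, a, c} (by simp [L]) (by simp [L]) hne3
          (by simp [Finset.insert_subset_iff]) (by simp [Finset.insert_subset_iff])
      all_goals simp [hav.symm, hbv.symm, hcv.symm] at hve
    by_cases habc : {a, b, c} ∈ T
    · exact nonempty_homeomorph_tetrahedron hav.symm hbv.symm hcv.symm hab hac hcb.symm
        (hT.eq_tetrahedron hav.symm hbv.symm hcv.symm hvab ht hvac habc hne1 hne2 hne3)
    · obtain ⟨T', hT', hne', hcard, hverts, ⟨φ⟩⟩ := hT.exists_unsubdivide hav.symm hbv.symm hcv.symm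
        hab hac hcb.symm hvab ht hvac habc hstar
      obtain ⟨ψ⟩ := ih _ (by omega : (triVerts T').card < n) T' hT' hne' (by omega) rfl
      exact ⟨φ.trans ψ⟩
  · by_cases h1 : {a, c} ∈ triEdges T
    · by_cases h2 : {b, d} ∈ triEdges T
      · exact (hT.not_crossing hχ hav.symm hbv.symm hcv.symm hdv.symm hab hac had hcb.symm
          hdb.symm hdc.symm ht hvcd (mem_triEdges.2 ⟨Finset.card_pair hav.symm, _, hvba, by
            intro x; simp; tauto⟩) h1 h2).elim
      · exact hflip hcv.symm hdb.symm hbv.symm hdv.symm hcb hdc.symm ht' hvcd h2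
    · exact hflip hbv.symm hac hav.symm hcv.symm hab.symm hcb.symm hvba ht h1

end IsSurface

end Spheres

/-! ### The double cover of a cocycle; on a sphere, cocycles are coboundaries. -/

section DoubleCover

variable {V : Type*} [DecidableEq V]

/-- A function on edges as a symmetric function of two vertices. -/
def edgeFun (z : Finset V → ZMod 2) (x y : V) : ZMod 2 := if x = y then 0 else z {x, y}

lemma edgeFun_self (z : Finset V → ZMod 2) (x : V) : edgeFun z x x = 0 := if_pos rfl

lemma edgeFun_comm (z : Finset V → ZMod 2) (x y : V) : edgeFun z x y = edgeFun z y x := by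
  simp [edgeFun, eq_comm, Finset.pair_comm]

/-- This is the cocycle condition on `t`; the value 0 on the diagonal makes it valid for repeated
vertices too. -/
lemma edgeFun_add {z : Finset V → ZMod 2} {t : Finset V} (ht : t.card = 3)
    (hz : ∑ e ∈ t.powersetCard 2, z e = 0) {x y w : V} (hx : x ∈ t) (hy : y ∈ t) (hw : w ∈ t) :
    edgeFun z x y + edgeFun z y w = edgeFun z x w := by
  by_cases hxy : x = y
  · rw [hxy, edgeFun_self, zero_add]
  by_cases hyw : y = w
  · rw [hyw, edgeFun_self, add_zero]
  by_cases hxw : x = w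
  · rw [hxw, edgeFun_self, edgeFun_comm z y w, CharTwo.add_self_eq_zero]
  have hn1 : ({x, y} : Finset V) ≠ {y, w} := fun h => by
    have : x ∈ ({y, w} : Finset V) := h ▸ (by simp)
    simp [hxy, hxw] at this
  have hn2 : ({x, y} : Finset V) ≠ {x, w} := fun h => by
    have : y ∈ ({x, w} : Finset V) := h ▸ (by simp)
    simp [hyw, Ne.symm hxy] at this
  have hn3 : ({y, w} : Finset V) ≠ {x, w} := fun h => by
    have : y ∈ ({x, w} : Finset V) := h ▸ (by simp)
    simp [hyw, Ne.symm hxy] at this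
  have hP : ({{x, y}, {y, w}, {x, w}} : Finset (Finset V)) = t.powersetCard 2 := by
    apply Finset.eq_of_subset_of_card_le
    · intro e he
      simp only [Finset.mem_insert, Finset.mem_singleton] at he
      rw [Finset.mem_powersetCard]
      rcases he with rfl | rfl | rfl
      · exact ⟨by simp [Finset.insert_subset_iff, *], Finset.card_pair hxy⟩
      · exact ⟨by simp [Finset.insert_subset_iff, *], Finset.card_pair hyw⟩
      · exact ⟨by simp [Finset.insert_subset_iff, *], Finset.card_pair hxw⟩
    · rw [Finset.card_powersetCard, ht, Finset.card_three_of_ne hn1 hn2 hn3]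
      decide
  rw [← hP, Finset.sum_insert (by simp [hn1, hn2]), Finset.sum_pair hn3, ← add_assoc] at hz
  simp only [edgeFun, hxy, hyw, hxw, if_false]
  exact CharTwo.add_eq_zero.1 hz

/-- The double cover of the realization of `T` attached to the cocycle `z`. -/
def doubleCover (T : Finset (Finset V)) (z : Finset V → ZMod 2) : Set (V → ZMod 2 → ℝ) :=
  {g | (∀ x i, 0 ≤ g x i) ∧ ∃ t ∈ T, ∃ v ∈ t, ∃ i : ZMod 2,
    (∀ x j, g x j ≠ 0 → x ∈ t ∧ j = i + edgeFun z v x) ∧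
    ∑ x ∈ t, (g x 0 + g x 1) = 1}

/-- The sheet `i` over the open star of `v`. -/
def sheet (z : Finset V → ZMod 2) (v : V) (i : ZMod 2) (f : V → ℝ) : V → ZMod 2 → ℝ :=
  fun x j => if j = i + edgeFun z v x then f x else 0

/-- The projection of the double cover. -/
noncomputable def coverProj (g : V → ZMod 2 → ℝ) : V → ℝ := fun x => g x 0 + g x 1

lemma ZMod.two_cases (i : ZMod 2) : i = 0 ∨ i = 1 := by
  revert i
  decide

lemma coverProj_sheet (z : Finset V → ZMod 2) (v : V) (i : ZMod 2) (f : V → ℝ) :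
    coverProj (sheet z v i f) = f := by
  ext x
  simp only [coverProj, sheet]
  rcases ZMod.two_cases (i + edgeFun z v x) with h | h <;> simp [h]

variable {T : Finset (Finset V)} {z : Finset V → ZMod 2}

lemma coverProj_mem {g : V → ZMod 2 → ℝ} (hg : g ∈ doubleCover T z) :
    coverProj g ∈ triReal T := by
  obtain ⟨h0, t, ht, v, hv, i, h1, h2⟩ := hg
  refine ⟨fun x => add_nonneg (h0 x 0) (h0 x 1), t, ht, fun x hx => ?_, h2⟩
  have hx' : ∀ j, g x j = 0 := fun j => by
    by_contra h
    exact hx (h1 x j h).1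
  simp [coverProj, hx']

lemma sheet_mem {f : V → ℝ} (hf : f ∈ triReal T) {v : V} (hv : f v ≠ 0) (i : ZMod 2) :
    sheet z v i f ∈ doubleCover T z := by
  obtain ⟨h0, t, ht, hout, hsum⟩ := hf
  refine ⟨fun x j => ?_, t, ht, v, ?_, i, fun x j hx => ?_, ?_⟩
  · unfold sheet
    split_ifs
    · exact h0 x
    · exact le_rfl
  · by_contra h
    exact hv (hout v h)
  · unfold sheet at hx
    split_ifs at hx with h
    · refine ⟨?_, h⟩
      by_contra h'
      exact hx (hout x h')
    · exact absurd rfl hx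
  · rw [← hsum]
    exact Finset.sum_congr rfl fun x _ => congrFun (coverProj_sheet z v i f) x

/-- The sheets of `g` at the vertices of its carrier differ by the cocycle. -/
lemma sheet_index (hcard : ∀ t ∈ T, t.card = 3) (hz : ∀ t ∈ T, ∑ e ∈ t.powersetCard 2, z e = 0)
    {g : V → ZMod 2 → ℝ} (hg : g ∈ doubleCover T z) {v x : V} {i j : ZMod 2} (hv : g v i ≠ 0)
    (hx : g x j ≠ 0) : j = i + edgeFun z v x := by
  obtain ⟨-, t, ht, w, hw, k, h1, -⟩ := hg
  obtain ⟨hvt, rfl⟩ := h1 v i hv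
  obtain ⟨hxt, rfl⟩ := h1 x j hx
  rw [add_assoc, edgeFun_add (hcard t ht) (hz t ht) hw hvt hxt]

/-- By `sheet_index`, one occupied sheet at one vertex determines those at all vertices of the
support, so `g` is recovered from its projection. -/
lemma eq_sheet (hcard : ∀ t ∈ T, t.card = 3) (hz : ∀ t ∈ T, ∑ e ∈ t.powersetCard 2, z e = 0)
    {g : V → ZMod 2 → ℝ} (hg : g ∈ doubleCover T z) {v : V} {i : ZMod 2} (hv : g v i ≠ 0) :
    sheet z v i (coverProj g) = g := by
  have key : ∀ x j, g x j ≠ 0 → j = i + edgeFun z v x := fun x j hx =>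
    sheet_index hcard hz hg hv hx
  ext x j
  unfold sheet
  split_ifs with h
  · have h' : g x (j + 1) = 0 := by
      by_contra hne
      have := (key x _ hne).trans h.symm
      simp at this
    rcases ZMod.two_cases j with rfl | rfl
    · simpa [coverProj] using h'
    · simpa [coverProj, show (1 + 1 : ZMod 2) = 0 by decide] using h'
  · by_contra h'
    exact h (key x j (Ne.symm h'))

/-- Only one sheet at a vertex is occupied. -/
lemma ne_of_proj_ne (hcard : ∀ t ∈ T, t.card = 3)
    (hz : ∀ t ∈ T, ∑ e ∈ t.powersetCard 2, z e = 0) {g : V → ZMod 2 → ℝ}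
    (hg : g ∈ doubleCover T z) {v : V} (hv : coverProj g v ≠ 0) (i : ZMod 2) :
    g v i ≠ g v (i + 1) := by
  intro h
  have h01 : g v 0 = g v 1 := by
    rcases ZMod.two_cases i with rfl | rfl
    · simpa using h
    · simpa [show (1 + 1 : ZMod 2) = 0 by decide] using h.symm
  have h0 : g v 0 ≠ 0 := fun h0 => hv (by simp [coverProj, ← h01, h0])
  have := sheet_index hcard hz hg h0 (h01 ▸ h0 : g v 1 ≠ 0)
  rw [edgeFun_self] at this
  exact absurd this (by decide)

lemma continuous_coverProj {W : Type*} :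
    Continuous (coverProj : (W → ZMod 2 → ℝ) → W → ℝ) :=
  continuous_pi fun x => by unfold coverProj; fun_prop

lemma continuous_sheet (z : Finset V → ZMod 2) (v : V) (i : ZMod 2) :
    Continuous (sheet z v i) := by
  refine continuous_pi fun x => continuous_pi fun j => ?_
  unfold sheet
  split_ifs <;> fun_prop

lemma continuous_eval (v : V) (i : ZMod 2) : Continuous fun g : doubleCover T z => g.1 v i :=
  (continuous_apply i).comp ((continuous_apply v).comp continuous_subtype_val)

/-- The projection as a map of spaces. -/
noncomputable def coverMap (T : Finset (Finset V)) (z : Finset V → ZMod 2) (g : doubleCover T z) :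
    triReal T := ⟨coverProj g, coverProj_mem g.2⟩

/-- The occupied sheet at `v`. -/
noncomputable def sheetAt (v : V) (g : V → ZMod 2 → ℝ) : ZMod 2 := by
  -- The value 1 is also the default where neither sheet is occupied; the definition is meaningful
  -- only where the projection is nonzero at `v`.
  classical exact if g v 0 = 0 then 1 else 0

lemma sheetAt_ne {W : Type*} {v : W} {g : W → ZMod 2 → ℝ} (hv : coverProj g v ≠ 0) :
    g v (sheetAt v g) ≠ 0 := by
  unfold sheetAt
  split_ifs with h
  · intro h'
    exact hv (by simp [coverProj, h, h'])
  · exact h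

/-- Over the open star of a vertex `v`, the cover is a product with `ZMod 2`: the second coordinate
is the occupied sheet at `v`, and `sheet` is the inverse. -/
lemma isCoveringMap_coverMap (hcard : ∀ t ∈ T, t.card = 3)
    (hz : ∀ t ∈ T, ∑ e ∈ t.powersetCard 2, z e = 0) : IsCoveringMap (coverMap T z) := by
  have hcont : Continuous (coverMap T z) :=
    (continuous_coverProj.comp continuous_subtype_val).subtype_mk _
  intro f
  obtain ⟨v, hv⟩ : ∃ v, f.1 v ≠ 0 := by
    obtain ⟨-, t, -, -, hsum⟩ := f.2
    by_contra! h
    simp [h] at hsum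
  refine IsEvenlyCovered.to_isEvenlyCovered_preimage (I := ZMod 2) ?_
  have hU : IsOpen {f : triReal T | f.1 v ≠ 0} := by
    refine isOpen_ne.preimage (f := fun f : triReal T => f.1 v) ?_
    exact (continuous_apply v).comp continuous_subtype_val
  have sheetAt_eq : ∀ {g : V → ZMod 2 → ℝ} {i : ZMod 2}, g ∈ doubleCover T z → g v i ≠ 0 →
      sheetAt v g = i := by
    intro g i hg hi
    have hp : coverProj g v ≠ 0 := by
      intro h
      have h0 := hg.1 v 0
      have h1 := hg.1 v 1
      have h2 : g v 0 + g v 1 = 0 := h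
      rcases ZMod.two_cases i with rfl | rfl
      · exact hi (by linarith)
      · exact hi (by linarith)
    have := sheet_index hcard hz hg hi (sheetAt_ne hp)
    rwa [edgeFun_self, add_zero] at this
  refine ⟨inferInstance, {f | f.1 v ≠ 0}, hv, hU, hU.preimage hcont,
    { toFun := fun g => (⟨coverMap T z g.1, g.2⟩, sheetAt v g.1.1)
      invFun := fun p => ⟨⟨sheet z v p.2 p.1.1.1, sheet_mem p.1.1.2 p.1.2 p.2⟩, by
        change coverProj (sheet z v p.2 p.1.1.1) v ≠ 0
        rw [coverProj_sheet]
        exact p.1.2⟩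
      left_inv := fun g => Subtype.ext (Subtype.ext
        (eq_sheet hcard hz g.1.2 (sheetAt_ne g.2)))
      right_inv := fun p => ?_
      continuous_toFun := ?_
      continuous_invFun := ?_ }, fun g => rfl⟩
  · refine Prod.ext (Subtype.ext (Subtype.ext (coverProj_sheet z v p.2 p.1.1.1))) ?_
    refine sheetAt_eq (sheet_mem p.1.1.2 p.1.2 p.2) ?_
    have h : p.1.1.1 v ≠ 0 := p.1.2
    simpa [sheet, edgeFun_self] using h
  · refine Continuous.prodMk (Continuous.subtype_mk (hcont.comp continuous_subtype_val) _) ?_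
    rw [continuous_discrete_rng]
    intro i
    -- Local constancy of the occupied sheet: each of its fibres is given by an open condition.
    have : (fun g : coverMap T z ⁻¹' {f | f.1 v ≠ 0} => sheetAt v g.1.1) ⁻¹' {i} =
        {g | g.1.1 v i ≠ 0} := by
      ext g
      constructor
      · intro h
        have h' : sheetAt v g.1.1 = i := h
        rw [Set.mem_ofPred_eq, ← h']
        exact sheetAt_ne g.2
      · exact fun h => sheetAt_eq g.1.2 h
    rw [this]
    refine isOpen_ne.preimage (f := fun g : coverMap T z ⁻¹' {f | f.1 v ≠ 0} => g.1.1 v i) ?_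
    exact (continuous_eval v i).comp continuous_subtype_val
  · refine Continuous.subtype_mk (Continuous.subtype_mk ?_ _) _
    rw [continuous_prod_of_discrete_right]
    intro i
    exact (continuous_sheet z v i).comp
      (continuous_subtype_val.comp continuous_subtype_val)

/-- Along a connected family over the open star of `v` the sheet does not change. -/
lemma sheet_const {Z : Type*} [TopologicalSpace Z] [PreconnectedSpace Z]
    (hcard : ∀ t ∈ T, t.card = 3) (hz : ∀ t ∈ T, ∑ e ∈ t.powersetCard 2, z e = 0)
    {k : Z → doubleCover T z} (hk : Continuous k) {v : V}
    (hv : ∀ a, coverProj (k a).1 v ≠ 0) {i : ZMod 2} {a : Z} (ha : (k a).1 v i ≠ 0) (b : Z) :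
    (k b).1 v i ≠ 0 := by
  intro hb
  -- Exactly one of the two weights at `v` is nonzero, so their difference never vanishes and cannot
  -- change sign.
  have hD : Continuous fun a => (k a).1 v i - (k a).1 v (i + 1) :=
    ((continuous_eval v i).comp hk).sub ((continuous_eval v (i + 1)).comp hk)
  have hne : ∀ a, (k a).1 v i - (k a).1 v (i + 1) ≠ 0 := fun a =>
    sub_ne_zero.2 (ne_of_proj_ne hcard hz (k a).2 (hv a) i)
  have h1 : (k b).1 v i - (k b).1 v (i + 1) ≤ 0 := by
    rw [hb]
    linarith [(k b).2.1 v (i + 1)]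
  have h2 : 0 ≤ (k a).1 v i - (k a).1 v (i + 1) := by
    have : (k a).1 v (i + 1) = 0 := by
      by_contra h
      have := sheet_index hcard hz (k a).2 ha h
      rw [edgeFun_self] at this
      simp at this
    rw [this, sub_zero]
    exact (k a).2.1 v i
  obtain ⟨c, -, hc⟩ := isPreconnected_univ.intermediate_value (Set.mem_univ b) (Set.mem_univ a)
    hD.continuousOn ⟨h1, h2⟩
  exact hne c hc

/-- The point of the edge `uw` with second barycentric coordinate `r`. -/
noncomputable def segPoint (u w : V) (r : ℝ) : V → ℝ := fun x =>
  if x = u then 1 - r else if x = w then r else 0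

/-- If the realization of a surface is a sphere, every cocycle is a coboundary. -/
theorem exists_coboundary (hT : IsSurface T) (hz : ∀ t ∈ T, ∑ e ∈ t.powersetCard 2, z e = 0)
    (φ : triReal T ≃ₜ Metric.sphere (0 : EuclideanSpace ℝ (Fin 3)) 1) {t₀ : Finset V}
    (ht₀ : t₀ ∈ T) : ∃ y : V → ZMod 2, ∀ e ∈ triEdges T, z e = ∑ v ∈ e, y v := by
  have hcard := hT.card_eq
  -- The barycenter of `t₀` has three nonzero coordinates, so it lies on no edge.
  let p₀ : triReal T := ⟨fun x => if x ∈ t₀ then 1 / 3 else 0, fun x => by positivity,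
    t₀, ht₀, fun x hx => by simp [hx], by
      rw [Finset.sum_ite_of_true (fun x hx => hx)]
      simp [hcard t₀ ht₀]⟩
  have hN : ‖(φ p₀).1‖ = 1 := mem_sphere_zero_iff_norm.1 (φ p₀).2
  let st := stereographic hN
  have hst : Continuous st.symm :=
    (isOpenEmbedding_stereographic_symm hN).continuous
  let F : C((ℝ ∙ (φ p₀).1)ᗮ, triReal T) := ⟨fun a => φ.symm (st.symm a), by fun_prop⟩
  obtain ⟨v₀, hv₀⟩ : ∃ v, (F 0).1 v ≠ 0 := by
    obtain ⟨-, t, -, -, hsum⟩ := (F 0).2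
    by_contra! h
    simp [h] at hsum
  let e₀ : doubleCover T z := ⟨sheet z v₀ 0 (F 0).1, sheet_mem (F 0).2 hv₀ 0⟩
  -- The domain of `F` is a real vector space, hence simply connected, so `F` lifts to the cover.
  -- Composing the lift with the stereographic chart gives the section `s` away from `p₀`.
  obtain ⟨G, ⟨-, hG⟩, -⟩ := (isCoveringMap_coverMap hcard hz).existsUnique_continuousMap_lifts F 0 e₀
    (Subtype.ext (coverProj_sheet z v₀ 0 (F 0).1))
  let s : {f : triReal T // f ≠ p₀} → doubleCover T z := fun f => G (st (φ f.1))
  have hmem : ∀ f : {f : triReal T // f ≠ p₀}, φ f.1 ∈ st.source := fun f => by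
    rw [stereographic_source, Set.mem_compl_iff, Set.mem_singleton_iff]
    exact fun h => f.2 (φ.injective h)
  have hs : Continuous s := by
    refine G.continuous.comp ?_
    exact st.continuousOn.comp_continuous (φ.continuous.comp continuous_subtype_val) hmem
  have hps : ∀ f, coverProj (s f).1 = f.1.1 := fun f => by
    have h1 : coverMap T z (G (st (φ f.1))) = F (st (φ f.1)) := congrFun hG _
    have h2 : F (st (φ f.1)) = f.1 := by
      change φ.symm (st.symm (st (φ f.1))) = f.1
      rw [st.left_inv (hmem f), φ.symm_apply_apply]
    exact congrArg Subtype.val (h1.trans h2)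
  have seg_mem : ∀ {u w : V}, u ≠ w → ∀ {τ : Finset V}, τ ∈ T → u ∈ τ → w ∈ τ →
      ∀ {r : ℝ}, 0 ≤ r → r ≤ 1 → segPoint u w r ∈ triReal T := by
    intro u w huw τ hτ hu hw r h0 h1
    refine ⟨fun x => ?_, τ, hτ, fun x hx => ?_, ?_⟩
    · unfold segPoint
      split_ifs <;> linarith
    · have h2 : x ≠ u := fun h => hx (h ▸ hu)
      have h3 : x ≠ w := fun h => hx (h ▸ hw)
      simp [segPoint, h2, h3]
    · have : ∑ x ∈ τ, segPoint u w r x = ∑ x ∈ ({u, w} : Finset V), segPoint u w r x := by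
        symm
        apply Finset.sum_subset
        · simp [Finset.insert_subset_iff, hu, hw]
        · intro x _ hx
          simp only [Finset.mem_insert, Finset.mem_singleton, not_or] at hx
          simp [segPoint, hx]
      rw [this, Finset.sum_pair huw]
      simp [segPoint, huw.symm]
  have seg_ne : ∀ (u w : V) (r : ℝ) (h : segPoint u w r ∈ triReal T),
      (⟨segPoint u w r, h⟩ : triReal T) ≠ p₀ := by
    intro u w r h heq
    have h1 : segPoint u w r = p₀.1 := congrArg Subtype.val heq
    have hc : ({u, w} : Finset V).card < t₀.card := by
      rw [hcard t₀ ht₀]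
      exact lt_of_le_of_lt Finset.card_le_two (by norm_num)
    obtain ⟨x, hx, hx'⟩ := Finset.exists_mem_notMem_of_card_lt_card hc
    simp only [Finset.mem_insert, Finset.mem_singleton, not_or] at hx'
    have h2 := congrFun h1 x
    simp [segPoint, hx', p₀, hx] at h2
  -- At parameter 0 the point is the vertex `u` itself, whatever `w` is.
  have hvert : ∀ u ∈ triVerts T, ∃ q : {f : triReal T // f ≠ p₀}, ∀ w, q.1.1 = segPoint u w 0 := by
    intro u hu
    obtain ⟨τ, hτ, huτ⟩ := mem_triVerts.1 hu
    obtain ⟨w, hw, hwu⟩ := Finset.exists_mem_ne (by rw [hcard τ hτ]; omega) u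
    have hm := seg_mem hwu.symm hτ huτ hw le_rfl zero_le_one
    refine ⟨⟨⟨segPoint u w 0, hm⟩, seg_ne _ _ _ _⟩, fun w' => ?_⟩
    ext x
    simp [segPoint]
  let y : V → ZMod 2 := fun u =>
    if h : u ∈ triVerts T then sheetAt u (s (hvert u h).choose).1 else 0
  -- From `u` to the midpoint, the coordinate at `u` stays at least 1/2, so the sheet of `s` at `u`
  -- persists.
  have half : ∀ {u w : V} (huw : u ≠ w) {τ : Finset V} (hτ : τ ∈ T) (hu : u ∈ τ) (hw : w ∈ τ)
      (hm : segPoint u w (1 / 2) ∈ triReal T),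
      (s ⟨⟨segPoint u w (1 / 2), hm⟩, seg_ne _ _ _ _⟩).1 u (y u) ≠ 0 := by
    intro u w huw τ hτ hu hw hm
    have hr : ∀ a : unitInterval, 0 ≤ (a : ℝ) / 2 ∧ (a : ℝ) / 2 ≤ 1 := fun a =>
      ⟨by linarith [a.2.1], by linarith [a.2.2]⟩
    let k : unitInterval → {f : triReal T // f ≠ p₀} := fun a =>
      ⟨⟨segPoint u w ((a : ℝ) / 2), seg_mem huw hτ hu hw (hr a).1 (hr a).2⟩, seg_ne _ _ _ _⟩
    have hk : Continuous k := by
      refine Continuous.subtype_mk (Continuous.subtype_mk (continuous_pi fun x => ?_) _) _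
      unfold segPoint
      split_ifs <;> fun_prop
    have hku : ∀ a, coverProj (s (k a)).1 u ≠ 0 := by
      intro a
      rw [hps]
      have : segPoint u w ((a : ℝ) / 2) u = 1 - (a : ℝ) / 2 := by simp [segPoint]
      change segPoint u w ((a : ℝ) / 2) u ≠ 0
      rw [this]
      linarith [a.2.2]
    have huT : u ∈ triVerts T := mem_triVerts.2 ⟨τ, hτ, hu⟩
    have hy : y u = sheetAt u (s (k 0)).1 := by
      have hq : (hvert u huT).choose = k 0 := by
        apply Subtype.ext
        apply Subtype.ext
        rw [(hvert u huT).choose_spec w]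
        simp [k]
      simp only [y, dif_pos huT, hq]
    have h0 : (s (k 0)).1 u (y u) ≠ 0 := by
      rw [hy]
      exact sheetAt_ne (hku 0)
    exact sheet_const hcard hz (hs.comp hk) hku h0 1
  refine ⟨y, fun e he => ?_⟩
  obtain ⟨hec, τ, hτ, heτ⟩ := mem_triEdges.1 he
  obtain ⟨u, w, huw, rfl⟩ := Finset.card_eq_two.1 hec
  have hu : u ∈ τ := heτ (by simp)
  have hw : w ∈ τ := heτ (by simp)
  have hswap : segPoint w u (1 / 2) = segPoint u w (1 / 2) := by
    ext x
    unfold segPoint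
    split_ifs with h1 h2
    · exact absurd (h1.symm.trans h2) huw.symm
    all_goals norm_num
  have hm := seg_mem huw hτ hu hw (r := 1 / 2) (by norm_num) (by norm_num)
  have h1 := half huw hτ hu hw hm
  have h2 := half huw.symm hτ hw hu (hswap ▸ hm)
  have h3 : (s ⟨⟨segPoint u w (1 / 2), hm⟩, seg_ne _ _ _ _⟩).1 w (y w) ≠ 0 := by
    have h : (⟨⟨segPoint u w (1 / 2), hm⟩, seg_ne _ _ _ _⟩ : {f : triReal T // f ≠ p₀}) =
        ⟨⟨segPoint w u (1 / 2), hswap ▸ hm⟩, seg_ne _ _ _ _⟩ :=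
      Subtype.ext (Subtype.ext hswap.symm)
    rw [h]
    exact h2
  -- At the midpoint both ends are occupied, in the sheets `y u` and `y w`, which therefore differ
  -- by the cocycle.
  have h4 := sheet_index hcard hz (s _).2 h1 h3
  rw [Finset.sum_pair huw, h4, ← add_assoc, CharTwo.add_self_eq_zero, zero_add]
  simp [edgeFun, huw]

end DoubleCover

/-! ### From simplicial complexes to surfaces. -/

namespace PreAbstractSimplicialComplex

variable {V : Type*} {X : PreAbstractSimplicialComplex V}

lemma mem_faces_of_subset {σ τ : Finset V} (hτ : τ ∈ X.faces) (h : σ ⊆ τ) (hσ : σ.Nonempty) :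
    σ ∈ X.faces := (X.isRelLowerSet_faces hτ).2 h hσ

lemma finite_vertexSet (hfin : X.faces.Finite) : X.vertexSet.Finite :=
  Set.Finite.preimage (f := fun v : V => ({v} : Finset V)) (fun _ _ _ _ h => by simpa using h) hfin

/-- A connected finite complex is connected as a graph. -/
lemma IsConnectedComplex.vertex_conn (hfin : X.faces.Finite) (hX : X.IsConnectedComplex)
    (P : V → Prop) (hP : ∀ σ ∈ X.faces, ∀ u ∈ σ, ∀ w ∈ σ, P u → P w) :
    ∀ u ∈ X.vertexSet, ∀ w ∈ X.vertexSet, P u → P w := by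
  classical
  intro u hu w hw hPu
  by_contra hPw
  have := (finite_vertexSet hfin).fintype
  have hconn : ConnectedSpace X.carrier := hX
  have single_mem : ∀ v : X.vertexSet, (Pi.single v 1 : X.vertexSet → unitInterval) ∈ X.carrier := by
    intro v
    refine ⟨?_, {v.1}, v.2, fun x => ?_⟩
    · rw [finsum_eq_single _ v (fun x hx => by simp [hx])]
      simp
    · by_cases h : x = v
      · simp [h]
      · have : x.1 ≠ v.1 := fun h' => h (Subtype.ext h')
        simp [h, this]
  -- The total weight on vertices satisfying `P` is 0 or 1 at every point, since `P` is constant on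
  -- each face; yet it is continuous and takes both values.
  let F : X.carrier → ℝ := fun f => ∑ v : X.vertexSet, if P v then (f.1 v : ℝ) else 0
  have hF : Continuous F := by
    refine continuous_finsetSum _ fun v _ => ?_
    split_ifs
    · exact continuous_subtype_val.comp ((continuous_apply v).comp continuous_subtype_val)
    · exact continuous_const
  have hF1 : F ⟨_, single_mem ⟨u, hu⟩⟩ = 1 := by
    simp only [F]
    rw [Finset.sum_eq_single ⟨u, hu⟩]
    · simp [hPu]
    · intro v _ hv
      simp [hv]
    · simp
  have hF0 : F ⟨_, single_mem ⟨w, hw⟩⟩ = 0 := by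
    refine Finset.sum_eq_zero fun v _ => ?_
    by_cases hv : v = ⟨w, hw⟩
    · simp [hv, hPw]
    · simp [hv]
  obtain ⟨f, -, hf⟩ := isPreconnected_univ.intermediate_value (Set.mem_univ _) (Set.mem_univ _)
    hF.continuousOn (show (1 / 2 : ℝ) ∈ Set.Icc (F ⟨_, single_mem ⟨w, hw⟩⟩)
      (F ⟨_, single_mem ⟨u, hu⟩⟩) by rw [hF0, hF1]; constructor <;> norm_num)
  obtain ⟨hsum, σ, hσ, hsupp⟩ := f.2
  rw [finsum_eq_sum_of_fintype] at hsum
  obtain ⟨x, hx⟩ := (X.isRelLowerSet_faces hσ).1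
  by_cases hPx : P x
  · have : F f = 1 := by
      rw [← hsum]
      refine Finset.sum_congr rfl fun v _ => ?_
      by_cases hv : f.1 v = 0
      · simp [hv]
      · rw [if_pos (hP σ hσ x hx v ((hsupp v).1 hv) hPx)]
    rw [this] at hf
    norm_num at hf
  · have : F f = 0 := by
      refine Finset.sum_eq_zero fun v _ => ?_
      by_cases hv : f.1 v = 0
      · simp [hv]
      · rw [if_neg fun h => hPx (hP σ hσ v ((hsupp v).1 hv) x hx h)]
    rw [this] at hf
    norm_num at hf

lemma HasDim.eq {d d' : ℕ} (h : X.HasDim d) (h' : X.HasDim d') : d = d' := by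
  obtain ⟨⟨σ, hσ, h1⟩, h2⟩ := h
  obtain ⟨⟨σ', hσ', h1'⟩, h2'⟩ := h'
  have := h2 σ' hσ'
  have := h2' σ hσ
  omega

/-- The 2-faces of a finite complex. -/
noncomputable def triangles (hfin : X.faces.Finite) : Finset (Finset V) :=
  hfin.toFinset.filter (·.card = 3)

lemma mem_triangles (hfin : X.faces.Finite) {t : Finset V} :
    t ∈ triangles hfin ↔ t ∈ X.faces ∧ t.card = 3 := by
  simp [triangles]

/-- By finiteness each face lies in a maximal one, which purity makes a triangle; so the triangles
determine the complex. -/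
lemma IsPure.mem_faces_iff (hfin : X.faces.Finite) (hX : X.IsPure 2) {σ : Finset V} :
    σ ∈ X.faces ↔ σ.Nonempty ∧ ∃ t ∈ triangles hfin, σ ⊆ t := by
  constructor
  · intro hσ
    obtain ⟨t, hle, ht⟩ := hfin.exists_le_maximal hσ
    exact ⟨(X.isRelLowerSet_faces hσ).1, t, (mem_triangles hfin).2 ⟨ht.prop, hX.2 t ht⟩, hle⟩
  · rintro ⟨hne, t, ht, hσt⟩
    exact mem_faces_of_subset ((mem_triangles hfin).1 ht).1 hσt hne

variable [DecidableEq V]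

lemma link_empty : X.link ∅ = X := by
  ext τ
  simp only [link, Finset.disjoint_empty_left, true_and, Finset.empty_union]
  exact ⟨fun h => h.2, fun h => ⟨(X.isRelLowerSet_faces h).1, h⟩⟩

lemma finite_link (hfin : X.faces.Finite) (σ : Finset V) : (X.link σ).faces.Finite :=
  hfin.subset fun _ hτ => mem_faces_of_subset hτ.2.2 Finset.subset_union_right hτ.1

lemma IsPure.coe_triVerts (hfin : X.faces.Finite) (hX : X.IsPure 2) :
    X.vertexSet = triVerts (triangles hfin) := by
  ext v
  rw [Finset.mem_coe, mem_triVerts]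
  change {v} ∈ X.faces ↔ _
  rw [hX.mem_faces_iff hfin]
  simp

lemma IsPure.coe_triEdges (hfin : X.faces.Finite) (hX : X.IsPure 2) :
    X.edges = triEdges (triangles hfin) := by
  ext e
  rw [Finset.mem_coe, mem_triEdges]
  change e ∈ X.faces ∧ e.card = 2 ↔ _
  rw [hX.mem_faces_iff hfin]
  constructor
  · rintro ⟨⟨_, h⟩, h2⟩
    exact ⟨h2, h⟩
  · rintro ⟨h2, h⟩
    exact ⟨⟨Finset.card_pos.1 (by omega), h⟩, h2⟩

/-- The triangles of a normal pseudomanifold of dimension two form a surface. -/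
lemma IsNormalPseudomanifold.isSurface (hfin : X.faces.Finite) (hX : X.IsNormalPseudomanifold 2) :
    IsSurface (triangles hfin) := by
  have hcard : ∀ t ∈ triangles hfin, t.card = 3 := fun t ht => ((mem_triangles hfin).1 ht).2
  have hpure : X.IsPure 2 := hX.1.2.1
  have hinter : ∀ s ∈ triangles hfin, ∀ t ∈ triangles hfin, ∀ e : Finset V, e.card = 2 → e ⊆ s →
      e ⊆ t → s = t ∨ (s ∩ t).card = 2 := by
    intro s hs t ht e he hes het
    by_cases hst : s = t
    · exact Or.inl hst
    · right
      rw [Finset.inter_eq_of_card he (hcard s hs) (hcard t ht) hes het hst, he]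
  have hstar : ∀ x : V, ∀ h : Finset V → Prop,
      (∀ s ∈ triangles hfin, ∀ t ∈ triangles hfin, x ∈ s → x ∈ t → (s ∩ t).card = 2 → h s → h t) →
      ∀ s ∈ triangles hfin, ∀ t ∈ triangles hfin, x ∈ s → x ∈ t → h s → h t := by
    intro x h hh s hs t ht hxs hxt hhs
    have hxF : {x} ∈ X.faces := (hpure.mem_faces_iff hfin).2 ⟨by simp, s, hs, by simpa⟩
    have hlink := hX.2 {x} (Or.inr hxF) (by simp)
    have step : ∀ y, y ≠ x → ∀ a ∈ triangles hfin, ∀ b ∈ triangles hfin, x ∈ a → y ∈ a → x ∈ b →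
        y ∈ b → h a → h b := by
      intro y hyx a ha b hb hxa hya hxb hyb hha
      rcases hinter a ha b hb {x, y} (Finset.card_pair hyx.symm)
        (by simp [Finset.insert_subset_iff, *]) (by simp [Finset.insert_subset_iff, *]) with hab | hab
      · rwa [← hab]
      · exact hh a ha b hb hxa hxb hab hha
    -- The predicate passes from triangles to link vertices: all triangles on the edge xy satisfy
    -- `h`. An edge yw of the link is the triangle xyw, which carries it from y to w.
    have hconn := hlink.vertex_conn (finite_link hfin {x})
      (fun y => ∀ a ∈ triangles hfin, x ∈ a → y ∈ a → h a) (by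
        rintro ρ ⟨-, hdis, hρ⟩ y hy w hw hPy a ha hxa hwa
        rw [Finset.disjoint_singleton_left] at hdis
        have hyx : y ≠ x := fun h => hdis (h ▸ hy)
        have hwx : w ≠ x := fun h => hdis (h ▸ hw)
        by_cases hyw : y = w
        · exact hPy a ha hxa (hyw ▸ hwa)
        · have h0 : {x, y, w} ∈ triangles hfin := by
            refine (mem_triangles hfin).2 ⟨mem_faces_of_subset hρ ?_ (by simp),
              Finset.card_three_of_ne hyx.symm hwx.symm hyw⟩
            simp [Finset.insert_subset_iff, hy, hw]
          exact step w hwx _ h0 a ha (by simp) (by simp) hxa hwa (hPy _ h0 (by simp) (by simp)))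
    have mem_link : ∀ a ∈ triangles hfin, x ∈ a → ∀ y ∈ a, y ≠ x →
        y ∈ (X.link {x}).vertexSet := by
      intro a ha hxa y hya hyx
      refine ⟨by simp, by simpa using hyx.symm, ?_⟩
      exact mem_faces_of_subset ((mem_triangles hfin).1 ha).1
        (Finset.union_subset (by simpa) (by simpa)) (by simp)
    obtain ⟨y, hy, hyx⟩ := Finset.exists_mem_ne (by rw [hcard s hs]; omega) x
    obtain ⟨w, hw, hwx⟩ := Finset.exists_mem_ne (by rw [hcard t ht]; omega) x
    exact hconn y (mem_link s hs hxs y hy hyx) w (mem_link t ht hxt w hw hwx)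
      (fun a ha hxa hya => step y hyx s hs a ha hxs hy hxa hya hhs) t ht hxt hw
  refine ⟨hcard, ?_, ?_⟩
  · rintro e he ⟨t, ht, het⟩
    have h2 := hX.1.2.2 e ((hpure.mem_faces_iff hfin).2 ⟨Finset.card_pos.1 (by omega), t, ht, het⟩) he
    rw [← h2, ← Set.ncard_coe_finset]
    congr 1
    ext s
    simp only [Finset.coe_filter, mem_triangles, Set.mem_ofPred_eq]
    tauto
  · intro σ hσ h hh s hs t ht hσs hσt hhs
    rcases Nat.lt_or_ge σ.card 1 with h0 | h1
    · have hσ0 : σ = ∅ := Finset.card_eq_zero.1 (by omega)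
      subst hσ0
      have hXc := hX.2 ∅ (Or.inl rfl) (by simp)
      rw [link_empty] at hXc
      have hst : ∀ x, ∀ a ∈ triangles hfin, ∀ b ∈ triangles hfin, x ∈ a → x ∈ b → h a → h b :=
        fun x => hstar x h fun a ha b hb _ _ => hh a ha b hb (by simp) (by simp)
      -- The same device globally: triangles sharing a vertex are already linked by `hstar`, so
      -- connectedness of the graph of `X` suffices.
      have hconn := hXc.vertex_conn hfin (fun y => ∀ a ∈ triangles hfin, y ∈ a → h a) (by
        intro ρ hρ y hy w hw hPy a ha hwa
        obtain ⟨-, b, hb, hρb⟩ := (hpure.mem_faces_iff hfin).1 hρ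
        exact hst w b hb a ha (hρb hw) hwa (hPy b hb (hρb hy)))
      obtain ⟨y, hy⟩ := Finset.card_pos.1 (by rw [hcard s hs]; omega : 0 < s.card)
      obtain ⟨w, hw⟩ := Finset.card_pos.1 (by rw [hcard t ht]; omega : 0 < t.card)
      rw [hpure.coe_triVerts hfin] at hconn
      exact hconn y (mem_triVerts.2 ⟨s, hs, hy⟩) w (mem_triVerts.2 ⟨t, ht, hw⟩)
        (fun a ha hya => hst y s hs a ha hy hya hhs) t ht hw
    · obtain ⟨x, rfl⟩ := Finset.card_eq_one.1 (le_antisymm hσ h1)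
      simp only [Finset.singleton_subset_iff] at hh hσs hσt
      exact hstar x h hh s hs t ht hσs hσt hhs

/-- The geometric carrier is the realization of the set of triangles. -/
lemma IsPure.nonempty_homeomorph (hfin : X.faces.Finite) (hX : X.IsPure 2) :
    Nonempty (X.carrier ≃ₜ triReal (triangles hfin)) := by
  classical
  let F : (X.vertexSet → unitInterval) → V → ℝ := fun f x =>
    if h : x ∈ X.vertexSet then (f ⟨x, h⟩ : ℝ) else 0
  -- Clamping to [0, 1] makes `G` total; it changes nothing on the realization, where all
  -- coordinates are at most 1.
  let G : (V → ℝ) → X.vertexSet → unitInterval := fun f v => Set.projIcc 0 1 zero_le_one (f v)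
  have hFG : ∀ f ∈ triReal (triangles hfin), (∀ v : X.vertexSet, (G f v : ℝ) = f v) ∧
      ∀ x ∉ X.vertexSet, f x = 0 := by
    rintro f ⟨h0, t, ht, hout, hsum⟩
    refine ⟨fun v => ?_, fun x hx => ?_⟩
    · have h1 : f v ≤ 1 := by
        by_cases hv : v.1 ∈ t
        · rw [← hsum]
          exact Finset.single_le_sum (fun x _ => h0 x) hv
        · rw [hout v hv]
          exact zero_le_one
      simp only [G]
      rw [Set.projIcc_of_mem zero_le_one ⟨h0 v, h1⟩]
    · refine hout x fun h => hx ?_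
      rw [hX.coe_triVerts hfin]
      exact mem_triVerts.2 ⟨t, ht, h⟩
  have hsum_eq : ∀ (g : V → ℝ) (t : Finset V), t ∈ triangles hfin → (∀ x ∉ t, g x = 0) →
      ∑ᶠ v : X.vertexSet, g v = ∑ x ∈ t, g x := by
    intro g t ht hout
    rw [finsum_set_coe_eq_finsum_mem X.vertexSet]
    apply finsum_mem_eq_sum_of_inter_support_eq
    ext x
    simp only [Set.mem_inter_iff, Function.mem_support, Finset.mem_coe]
    constructor
    · rintro ⟨-, h2⟩
      exact ⟨by_contra fun h => h2 (hout x h), h2⟩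
    · rintro ⟨h1, h2⟩
      refine ⟨?_, h2⟩
      rw [hX.coe_triVerts hfin]
      exact mem_triVerts.2 ⟨t, ht, h1⟩
  have hFv : ∀ f (v : X.vertexSet), F f v = f v := fun f v => by simp [F]
  refine ⟨homeomorphOfInvOn F G ?_ ?_ ?_ ?_ ?_ ?_⟩
  · refine continuous_pi fun x => ?_
    by_cases h : x ∈ X.vertexSet
    · simp only [F, h, dif_pos]
      exact continuous_subtype_val.comp (continuous_apply _)
    · simp only [F, h, dif_neg, not_false_iff]
      exact continuous_const
  · exact continuous_pi fun v => continuous_projIcc.comp (continuous_apply _)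
  · rintro f ⟨hsum, σ, hσ, hsupp⟩
    obtain ⟨-, t, ht, hσt⟩ := (hX.mem_faces_iff hfin).1 hσ
    have hout : ∀ x ∉ t, F f x = 0 := by
      intro x hx
      by_cases h : x ∈ X.vertexSet
      · have : f ⟨x, h⟩ = 0 := by
          by_contra hne
          exact hx (hσt ((hsupp ⟨x, h⟩).1 hne))
        simp [F, this]
      · simp [F, h]
    refine ⟨fun x => ?_, t, ht, hout, ?_⟩
    · simp only [F]
      split_ifs with h
      · exact (f ⟨x, h⟩).2.1
      · exact le_rfl
    · rw [← hsum_eq (F f) t ht hout, ← hsum]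
      simp only [hFv]
  · intro f hf
    obtain ⟨hG, -⟩ := hFG f hf
    obtain ⟨h0, t, ht, hout, hsum⟩ := hf
    -- The carrier asks for the exact support, which may be a proper face of `t`.
    refine ⟨?_, t.filter (f · ≠ 0), ?_, fun v => ?_⟩
    · simp only [hG]
      rw [hsum_eq f t ht hout, hsum]
    · refine mem_faces_of_subset ((mem_triangles hfin).1 ht).1 (Finset.filter_subset _ _) ?_
      by_contra hne
      rw [Finset.not_nonempty_iff_eq_empty, Finset.filter_eq_empty_iff] at hne
      rw [Finset.sum_eq_zero fun x hx => by simpa using hne hx] at hsum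
      exact zero_ne_one hsum
    · have : G f v ≠ 0 ↔ f v ≠ 0 := by
        rw [← hG v]
        simp
      rw [this, Finset.mem_filter]
      exact ⟨fun h => ⟨by_contra fun h' => h (hout _ h'), h⟩, fun h => h.2⟩
  · rintro f -
    ext v
    simp only [G, hFv]
    rw [Set.projIcc_of_mem zero_le_one (f v).2]
  · intro f hf
    obtain ⟨hG, hz⟩ := hFG f hf
    ext x
    by_cases h : x ∈ X.vertexSet
    · rw [hFv (G f) ⟨x, h⟩, hG]
    · simp [F, h, hz x h]

end PreAbstractSimplicialComplex

/-! ### The main theorem. -/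

theorem mainTheorem3 {V : Type*} [DecidableEq V] (X : PreAbstractSimplicialComplex V)
    (hfin : X.faces.Finite) (hX : X.IsNormalPseudomanifold 2) :
    X.IsRigid 3 ∧ (X.IsMinimallyRigid 3 ↔ X.IsTriangulatedSphere 2) := by
  have hT := hX.isSurface hfin
  have hpure : X.IsPure 2 := hX.1.2.1
  have hdim : X.HasDim 2 := hpure.1
  have hverts := hpure.coe_triVerts hfin
  have hedges := hpure.coe_triEdges hfin
  obtain ⟨ψ⟩ := hpure.nonempty_homeomorph hfin
  obtain ⟨t₀, ht₀, ht₀c⟩ := hdim.1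
  have ht₀T : t₀ ∈ PreAbstractSimplicialComplex.triangles hfin :=
    (PreAbstractSimplicialComplex.mem_triangles hfin).2 ⟨ht₀, ht₀c⟩
  have hrigid : X.IsRigid 3 := by
    refine ⟨?_, 2, hdim, ?_⟩
    · have := hX.2 ∅ (Or.inl rfl) (by simp)
      rwa [PreAbstractSimplicialComplex.link_empty] at this
    · rintro A hA ⟨σ, hσ, hσc, hAσ⟩
      rw [hverts] at hA
      have h := hT.rigid ((PreAbstractSimplicialComplex.mem_triangles hfin).2 ⟨hσ, hσc⟩) A hA hAσ
      have hset : {e ∈ X.edges | ∃ v ∈ e, v ∈ A} =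
          edgesMeeting (PreAbstractSimplicialComplex.triangles hfin) A := by
        ext e
        simp [edgesMeeting, hedges]
      rwa [hset, Set.ncard_coe_finset]
  refine ⟨hrigid, ?_⟩
  have h23 := hT.two_mul_card_edges
  -- f₁ = 3(f₀ - 3) + 3 combined with 2f₁ = 3f₂ is f₂ + 4 = 2f₀.
  have hmin : X.IsMinimallyRigid 3 ↔ (PreAbstractSimplicialComplex.triangles hfin).card + 4 =
      2 * (triVerts (PreAbstractSimplicialComplex.triangles hfin)).card := by
    constructor
    · rintro ⟨-, d, hd, h⟩
      have hd2 := hd.eq hdim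
      subst hd2
      rw [hverts, hedges, Set.ncard_coe_finset, Set.ncard_coe_finset,
        show Nat.choose (2 + 1) 2 = 3 by decide] at h
      push_cast at h
      omega
    · intro h
      refine ⟨hrigid, 2, hdim, ?_⟩
      rw [hverts, hedges, Set.ncard_coe_finset, Set.ncard_coe_finset,
        show Nat.choose (2 + 1) 2 = 3 by decide]
      push_cast
      omega
  rw [hmin]
  constructor
  · intro h
    obtain ⟨φ⟩ := IsSurface.nonempty_homeomorph_sphere _ _ hT ⟨t₀, ht₀T⟩ h rfl
    exact ⟨ψ.trans φ⟩
  · rintro ⟨φ⟩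
    exact hT.card_eq_of_cocycles ⟨t₀, ht₀T⟩ fun z hz =>
      exists_coboundary hT hz (ψ.symm.trans φ) ht₀T
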